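/- All supergroups are affine algebraic supergroups over $\mathbb C$, i.e. they are given by a finitely generated supercommutative Hopf superalgebra $\mathbb C[G]$, and $\operatorname{Rep} G$ is the symmetric monoidal category of finite-dimensional representations of $G$ (finite-dimensional $\mathbb C[G]$-supercomodules) and parity-preserving $G$-maps. A supergroup $G$, not necessarily connected, is quasireductive if the identity component of its underlying even algebraic group $G_0$ is reductive; equivalently, if every finite-dimensional representation of $G_0$ is completely reducible. A closed quasireductive subgroup $K\subseteq G$ is splitting if the natural $G$-map $\mathbb C\to\operatorname{Ind}_K^G\mathbb C$, $1\mapsto 1$, has a $G$-equivariant left inverse, where $\operatorname{Ind}_K^G\mathbb C=\{a\in\mathbb C[G] : a(kg)=a(g)\}$ with $G$ acting by right translation. In a rigid symmetric monoidal $\mathbb C$-linear category $\mathcal C$ the trace of $f:X\to X$ is the composition $$\mathbf 1\xrightarrow{\ \mathrm{coev}\ }X\otimes X^*\xrightarrow{\ f\otimes 1\ }X\otimes X^*\cong X^*\otimes X\xrightarrow{\ \mathrm{ev}\ }\mathbf 1 ,$$ a morphism $f:X\to Y$ is negligible if $\operatorname{tr}(fg)=0$ for all $g:Y\to X$, and the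 semisimplification $\overline{\mathcal C}$ is the quotient of $\mathcal C$ by the tensor ideal of negligible morphisms, with quotient functor $S:\mathcal C\to\overline{\mathcal C}$. **Theorem.** Let $G$ be a quasireductive supergroup over $\mathbb C$ and let $K\subseteq G$ be a splitting subgroup. Then: 1. The functor $\operatorname{Res}:\operatorname{Rep} G\to\operatorname{Rep} K$ takes negligible morphisms to negligible morphisms. 2. There is a functor $F:\overline{\operatorname{Rep} G}\to\overline{\operatorname{Rep} K}$ with $F\circ S=S\circ\operatorname{Res}$ which is $\mathbb C$-linear, symmetric monoidal, exact (it preserves finite limits and finite colimits) and faithful, and for which the equality $F\circ S=S\circ\operatorname{Res}$ is an equality of monoidal functors. -/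

import Mathlib

open CategoryTheory MonoidalCategory
open scoped TensorProduct
open MonObj ComonObj
set_option linter.unusedSectionVars false

section KoszulLinear

variable {U V W : Type} [AddCommGroup U] [Module ℂ U] [AddCommGroup V] [Module ℂ V]
  [AddCommGroup W] [Module ℂ W]

/-- The Koszul swap `V ⊗ W → W ⊗ V` of two vector spaces graded by the `±1`-eigenspaces of
involutions `p` and `q`. On homogeneous vectors it is `v ⊗ w ↦ (-1)^(|v||w|) w ⊗ v`, see
`koszulL_even_left`, `koszulL_even_right`, `koszulL_odd_odd`. -/
noncomputable def koszulL (p : V →ₗ[ℂ] V) (q : W →ₗ[ℂ] W) : V ⊗[ℂ] W →ₗ[ℂ] W ⊗[ℂ] V :=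
  TensorProduct.lift <| LinearMap.mk₂ ℂ
    (fun v w => (2⁻¹ : ℂ) • (w ⊗ₜ[ℂ] v + w ⊗ₜ[ℂ] p v + q w ⊗ₜ[ℂ] v - q w ⊗ₜ[ℂ] p v))
    (fun v v' w => by simp only [map_add, TensorProduct.tmul_add]; module)
    (fun c v w => by simp only [map_smul, TensorProduct.tmul_smul]; module)
    (fun v w w' => by simp only [map_add, TensorProduct.add_tmul]; module)
    (fun c v w => by simp only [map_smul, ← TensorProduct.smul_tmul']; module)

lemma koszulL_tmul (p : V →ₗ[ℂ] V) (q : W →ₗ[ℂ] W) (v : V) (w : W) :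
    koszulL p q (v ⊗ₜ w) =
      (2⁻¹ : ℂ) • (w ⊗ₜ[ℂ] v + w ⊗ₜ[ℂ] p v + q w ⊗ₜ[ℂ] v - q w ⊗ₜ[ℂ] p v) := rfl

lemma koszulL_even_left (p : V →ₗ[ℂ] V) (q : W →ₗ[ℂ] W) {v : V} (w : W) (hv : p v = v) :
    koszulL p q (v ⊗ₜ w) = w ⊗ₜ[ℂ] v := by
  rw [koszulL_tmul, hv]; module

lemma koszulL_even_right (p : V →ₗ[ℂ] V) (q : W →ₗ[ℂ] W) (v : V) {w : W} (hw : q w = w) :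
    koszulL p q (v ⊗ₜ w) = w ⊗ₜ[ℂ] v := by
  rw [koszulL_tmul, hw]; module

lemma koszulL_odd_odd (p : V →ₗ[ℂ] V) (q : W →ₗ[ℂ] W) {v : V} {w : W} (hv : p v = -v)
    (hw : q w = -w) : koszulL p q (v ⊗ₜ w) = -(w ⊗ₜ[ℂ] v) := by
  rw [koszulL_tmul, hv, hw]
  simp only [TensorProduct.tmul_neg, TensorProduct.neg_tmul]
  module

lemma koszulL_comm {V' W' : Type} [AddCommGroup V'] [Module ℂ V'] [AddCommGroup W'] [Module ℂ W']
    {p : V →ₗ[ℂ] V} {q : W →ₗ[ℂ] W} {p' : V' →ₗ[ℂ] V'} {q' : W' →ₗ[ℂ] W'}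
    (f : V →ₗ[ℂ] V') (g : W →ₗ[ℂ] W') (hf : f ∘ₗ p = p' ∘ₗ f) (hg : g ∘ₗ q = q' ∘ₗ g) :
    koszulL p' q' ∘ₗ TensorProduct.map f g = TensorProduct.map g f ∘ₗ koszulL p q := by
  ext v w
  have hf' v : f (p v) = p' (f v) := LinearMap.congr_fun hf v
  have hg' v : g (q v) = q' (g v) := LinearMap.congr_fun hg v
  simp [koszulL_tmul, hf', hg']

lemma koszulL_koszulL {p : V →ₗ[ℂ] V} {q : W →ₗ[ℂ] W} (hp : ∀ v, p (p v) = v)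
    (hq : ∀ w, q (q w) = w) : koszulL q p ∘ₗ koszulL p q = LinearMap.id := by
  ext v w
  simp only [TensorProduct.AlgebraTensorModule.curry_apply, LinearMap.restrictScalars_self,
    TensorProduct.curry_apply, LinearMap.comp_apply, koszulL_tmul, map_smul, map_add, map_sub,
    hp, hq, LinearMap.id_apply]
  module

lemma koszulL_hexagon {o : U →ₗ[ℂ] U} {p : V →ₗ[ℂ] V} {q : W →ₗ[ℂ] W} (ho : ∀ v, o (o v) = v) :
    (TensorProduct.assoc ℂ V W U).toLinearMap ∘ₗ koszulL o (TensorProduct.map p q) ∘ₗ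
      (TensorProduct.assoc ℂ U V W).toLinearMap =
    (koszulL o q).lTensor V ∘ₗ (TensorProduct.assoc ℂ V U W).toLinearMap ∘ₗ
      (koszulL o p).rTensor W := by
  ext u v w
  simp [koszulL_tmul, TensorProduct.tmul_add, TensorProduct.add_tmul,
    TensorProduct.tmul_sub, TensorProduct.sub_tmul, ← TensorProduct.smul_tmul', ho]
  module

end KoszulLinear
/-- A complex super vector space: a complex vector space `V` with its parity involution `p`. The even
part `V₀` is the `+1`-eigenspace and the odd part `V₁` the `-1`-eigenspace of `p`, so that
`V = V₀ ⊕ V₁` and `p` is `(-1)^i` on `V_i`. -/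
structure SuperVect where
  V : ModuleCat.{0} ℂ
  p : V ⟶ V
  p_p : p ≫ p = 𝟙 V

namespace SuperVect

attribute [simp] p_p

/-- A morphism of super vector spaces: a linear map that preserves parity. -/
@[ext]
structure Hom (X Y : SuperVect) where
  hom : X.V ⟶ Y.V
  comm : X.p ≫ hom = hom ≫ Y.p

instance : Category SuperVect where
  Hom X Y := Hom X Y
  id X := ⟨𝟙 X.V, by simp⟩
  comp f g := ⟨f.hom ≫ g.hom, by rw [reassoc_of% f.comm, g.comm, Category.assoc]⟩

@[ext]
lemma hom_ext {X Y : SuperVect} {f g : X ⟶ Y} (h : f.hom = g.hom) : f = g := Hom.ext h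

@[simp] lemma id_hom (X : SuperVect) : (𝟙 X : X ⟶ X).hom = 𝟙 X.V := rfl
@[simp] lemma comp_hom {X Y Z : SuperVect} (f : X ⟶ Y) (g : Y ⟶ Z) :
    (f ≫ g).hom = f.hom ≫ g.hom := rfl

@[simps]
def mkIso {X Y : SuperVect} (e : X.V ≅ Y.V) (h : X.p ≫ e.hom = e.hom ≫ Y.p) : X ≅ Y where
  hom := ⟨e.hom, h⟩
  inv := ⟨e.inv, by rw [Iso.comp_inv_eq, Category.assoc, h, Iso.inv_hom_id_assoc]⟩

/-- The tensor product of super vector spaces, with `|v ⊗ w| = |v| + |w|`. -/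
instance : MonoidalCategoryStruct SuperVect where
  tensorObj X Y := ⟨X.V ⊗ Y.V, X.p ⊗ₘ Y.p, by simp⟩
  tensorUnit := ⟨𝟙_ _, 𝟙 _, by simp⟩
  whiskerLeft X _ _ f := ⟨X.V ◁ f.hom, by
    dsimp only
    rw [← id_tensorHom, tensorHom_comp_tensorHom, tensorHom_comp_tensorHom, f.comm]; simp⟩
  whiskerRight f Y := ⟨f.hom ▷ Y.V, by
    dsimp only
    rw [← tensorHom_id, tensorHom_comp_tensorHom, tensorHom_comp_tensorHom, f.comm]; simp⟩
  tensorHom f g := ⟨f.hom ⊗ₘ g.hom, by simp [f.comm, g.comm]⟩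
  associator X Y Z := mkIso (α_ _ _ _) (by simp)
  leftUnitor X := mkIso (λ_ _) (by simp)
  rightUnitor X := mkIso (ρ_ _) (by simp)

instance : MonoidalCategory SuperVect where
  tensorHom_def _ _ := hom_ext (MonoidalCategory.tensorHom_def _ _)
  id_tensorHom_id _ _ := hom_ext (MonoidalCategory.id_tensorHom_id _ _)
  tensorHom_comp_tensorHom _ _ _ _ := hom_ext (MonoidalCategory.tensorHom_comp_tensorHom _ _ _ _)
  whiskerLeft_id _ _ := hom_ext (MonoidalCategory.whiskerLeft_id _ _)
  id_whiskerRight _ _ := hom_ext (MonoidalCategory.id_whiskerRight _ _)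
  associator_naturality _ _ _ := hom_ext (MonoidalCategory.associator_naturality _ _ _)
  leftUnitor_naturality _ := hom_ext (MonoidalCategory.leftUnitor_naturality _)
  rightUnitor_naturality _ := hom_ext (MonoidalCategory.rightUnitor_naturality _)
  pentagon _ _ _ _ := hom_ext (MonoidalCategory.pentagon _ _ _ _)
  triangle _ _ := hom_ext (MonoidalCategory.triangle _ _)

instance (X Y : SuperVect) : Add (X ⟶ Y) := ⟨fun f g => ⟨f.hom + g.hom, by
  rw [Preadditive.comp_add, Preadditive.add_comp, f.comm, g.comm]⟩⟩
instance (X Y : SuperVect) : Zero (X ⟶ Y) := ⟨⟨0, by simp⟩⟩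
instance (X Y : SuperVect) : Neg (X ⟶ Y) := ⟨fun f => ⟨-f.hom, by simp [f.comm]⟩⟩
instance (X Y : SuperVect) : Sub (X ⟶ Y) := ⟨fun f g => ⟨f.hom - g.hom, by
  simp [f.comm, g.comm]⟩⟩
instance (X Y : SuperVect) : SMul ℂ (X ⟶ Y) := ⟨fun c f => ⟨c • f.hom, by
  rw [Linear.comp_smul, Linear.smul_comp, f.comm]⟩⟩
instance (X Y : SuperVect) : SMul ℕ (X ⟶ Y) := ⟨fun c f => ⟨c • f.hom, by
  rw [Preadditive.comp_nsmul, Preadditive.nsmul_comp, f.comm]⟩⟩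
instance (X Y : SuperVect) : SMul ℤ (X ⟶ Y) := ⟨fun c f => ⟨c • f.hom, by
  rw [Preadditive.comp_zsmul, Preadditive.zsmul_comp, f.comm]⟩⟩

lemma hom_injective (X Y : SuperVect) : Function.Injective (fun f : X ⟶ Y => f.hom) :=
  fun _ _ h => hom_ext h

instance (X Y : SuperVect) : AddCommGroup (X ⟶ Y) :=
  (hom_injective X Y).addCommGroup _ rfl (fun _ _ => rfl) (fun _ => rfl) (fun _ _ => rfl)
    (fun _ _ => rfl) (fun _ _ => rfl)

instance : Preadditive SuperVect where
  add_comp _ _ _ _ _ _ := hom_ext (Preadditive.add_comp _ _ _ _ _ _)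
  comp_add _ _ _ _ _ _ := hom_ext (Preadditive.comp_add _ _ _ _ _ _)

noncomputable instance (X Y : SuperVect) : Module ℂ (X ⟶ Y) :=
  (hom_injective X Y).module ℂ ⟨⟨fun f => f.hom, rfl⟩, fun _ _ => rfl⟩ (fun _ _ => rfl)

noncomputable instance : Linear ℂ SuperVect where
  smul_comp _ _ _ _ _ _ := hom_ext (Linear.smul_comp _ _ _ _ _ _)
  comp_smul _ _ _ _ _ _ := hom_ext (Linear.comp_smul _ _ _ _ _ _)

instance : MonoidalPreadditive SuperVect where
  whiskerLeft_zero := hom_ext (MonoidalPreadditive.whiskerLeft_zero)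
  zero_whiskerRight := hom_ext (MonoidalPreadditive.zero_whiskerRight)
  whiskerLeft_add _ _ := hom_ext (MonoidalPreadditive.whiskerLeft_add _ _)
  add_whiskerRight _ _ := hom_ext (MonoidalPreadditive.add_whiskerRight _ _)

instance : MonoidalLinear ℂ SuperVect where
  whiskerLeft_smul _ _ _ _ _ := hom_ext (MonoidalLinear.whiskerLeft_smul _ _ _)
  smul_whiskerRight _ _ _ _ _ := hom_ext (MonoidalLinear.smul_whiskerRight _ _ _)

lemma p_p_apply (X : SuperVect) (x : X.V) : X.p.hom (X.p.hom x) = x :=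
  LinearMap.congr_fun (congrArg ModuleCat.Hom.hom X.p_p) x

/-- The braiding of super vector spaces, `v ⊗ w ↦ (-1)^(|v||w|) w ⊗ v`. -/
noncomputable def koszulSwap (X Y : SuperVect) : X.V ⊗ Y.V ⟶ Y.V ⊗ X.V :=
  ModuleCat.ofHom (koszulL X.p.hom Y.p.hom)

lemma koszulSwap_natural {X Y X' Y' : SuperVect} (f : X ⟶ X') (g : Y ⟶ Y') :
    (f.hom ⊗ₘ g.hom) ≫ koszulSwap X' Y' = koszulSwap X Y ≫ (g.hom ⊗ₘ f.hom) :=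
  ModuleCat.hom_ext (koszulL_comm _ _ (congrArg ModuleCat.Hom.hom f.comm)
    (congrArg ModuleCat.Hom.hom g.comm))

lemma koszulSwap_koszulSwap (X Y : SuperVect) :
    koszulSwap X Y ≫ koszulSwap Y X = 𝟙 _ :=
  ModuleCat.hom_ext (koszulL_koszulL X.p_p_apply Y.p_p_apply)

/-- The parity involution, as an endomorphism. -/
def parity (X : SuperVect) : X ⟶ X := ⟨X.p, rfl⟩

@[simps]
noncomputable def braid (X Y : SuperVect) : X ⊗ Y ≅ Y ⊗ X where
  hom := ⟨koszulSwap X Y, koszulSwap_natural X.parity Y.parity⟩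
  inv := ⟨koszulSwap Y X, koszulSwap_natural Y.parity X.parity⟩
  hom_inv_id := hom_ext (koszulSwap_koszulSwap X Y)
  inv_hom_id := hom_ext (koszulSwap_koszulSwap Y X)

lemma braid_naturality {X Y X' Y' : SuperVect} (f : X ⟶ X') (g : Y ⟶ Y') :
    (f ⊗ₘ g) ≫ (braid X' Y').hom = (braid X Y).hom ≫ (g ⊗ₘ f) :=
  hom_ext (koszulSwap_natural f g)

lemma braid_hexagon (X Y Z : SuperVect) :
    (α_ X Y Z).hom ≫ (braid X (Y ⊗ Z)).hom ≫ (α_ Y Z X).hom =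
      ((braid X Y).hom ▷ Z) ≫ (α_ Y X Z).hom ≫ (Y ◁ (braid X Z).hom) :=
  hom_ext (ModuleCat.hom_ext (koszulL_hexagon X.p_p_apply))

noncomputable instance : BraidedCategory SuperVect where
  braiding := braid
  braiding_naturality_right X Y Z f := by
    simpa using braid_naturality (𝟙 X) f
  braiding_naturality_left f Z := by
    simpa using braid_naturality f (𝟙 Z)
  hexagon_forward := braid_hexagon
  hexagon_reverse X Y Z := by
    have h : α_ Z X Y ≪≫ braid Z (X ⊗ Y) ≪≫ α_ X Y Z =
        whiskerRightIso (braid Z X) Y ≪≫ α_ X Z Y ≪≫ whiskerLeftIso X (braid Z Y) :=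
      Iso.ext (braid_hexagon Z X Y)
    have h' := congrArg Iso.inv h
    simp only [Iso.trans_inv, Category.assoc, whiskerRightIso_inv, whiskerLeftIso_inv] at h'
    exact h'

noncomputable instance : SymmetricCategory SuperVect where
  symmetry X Y := hom_ext (koszulSwap_koszulSwap X Y)

/-- The unit element `1` of a superalgebra. -/
def one (A : SuperVect) [MonObj A] : A.V := η[A].hom.hom (1 : ℂ)

/-- The product `ab` of two elements of a superalgebra. -/
def mul (A : SuperVect) [MonObj A] (a b : A.V) : A.V := μ[A].hom.hom (a ⊗ₜ[ℂ] b)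

end SuperVect

section Semisimplification
universe v u
variable {C : Type u} [Category.{v} C] [MonoidalCategory C] [SymmetricCategory C]

/-- The trace of an endomorphism of `X`, formed with a chosen dual `Y` of `X`. -/
def traceWith {X : C} (Y : C) [ExactPairing X Y] (f : X ⟶ X) : 𝟙_ C ⟶ 𝟙_ C :=
  η_ X Y ≫ f ▷ Y ≫ (β_ X Y).hom ≫ ε_ X Y

lemma traceWith_comm {X Y X' Y' : C} [ExactPairing X Y] [ExactPairing X' Y']
    (f : X ⟶ X') (g : X' ⟶ X) : traceWith Y (f ≫ g) = traceWith Y' (g ≫ f) := by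
  let : HasRightDual X := ⟨Y⟩
  let : HasRightDual X' := ⟨Y'⟩
  obtain ⟨t, h1, h2⟩ : ∃ t : Y ⟶ Y', η_ X Y ≫ X ◁ t = η_ X' Y' ≫ g ▷ Y' ∧
      t ▷ X' ≫ ε_ X' Y' = Y ◁ g ≫ ε_ X Y :=
    ⟨rightAdjointMate g, coevaluation_comp_rightAdjointMate g, rightAdjointMate_comp_evaluation g⟩
  calc _ = η_ X Y ≫ f ▷ Y ≫ (β_ X' Y).hom ≫ Y ◁ g ≫ ε_ X Y := by
        rw [traceWith, comp_whiskerRight, Category.assoc,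
          BraidedCategory.braiding_naturality_left_assoc]
    _ = (η_ X Y ≫ X ◁ t) ≫ f ▷ Y' ≫ (β_ X' Y').hom ≫ ε_ X' Y' := by
        rw [← h2, Category.assoc, whisker_exchange_assoc,
          BraidedCategory.braiding_naturality_right_assoc]
    _ = _ := by
        rw [h1, traceWith, comp_whiskerRight, Category.assoc, Category.assoc]

/-- The partial trace over `Z` of a morphism `X ⊗ Z ⟶ Y ⊗ Z`. -/
def partialTrace {X Z : C} (Z' : C) [ExactPairing Z Z'] {Y : C} (h : X ⊗ Z ⟶ Y ⊗ Z) : X ⟶ Y :=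
  (ρ_ X).inv ≫ X ◁ η_ Z Z' ≫ (α_ X Z Z').inv ≫ h ▷ Z' ≫ (α_ Y Z Z').hom ≫
    Y ◁ ((β_ Z Z').hom ≫ ε_ Z Z') ≫ (ρ_ Y).hom

lemma partialTrace_comp {X Z Z' Y W : C} [ExactPairing Z Z'] (h : X ⊗ Z ⟶ Y ⊗ Z) (f : Y ⟶ W) :
    partialTrace Z' (h ≫ f ▷ Z) = partialTrace Z' h ≫ f := by
  calc _ = (ρ_ X).inv ≫ X ◁ η_ Z Z' ≫ (α_ X Z Z').inv ≫ h ▷ Z' ≫ (α_ Y Z Z').hom ≫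
        (f ▷ (Z ⊗ Z') ≫ W ◁ ((β_ Z Z').hom ≫ ε_ Z Z')) ≫ (ρ_ W).hom := by
        rw [partialTrace]
        monoidal
    _ = _ := by
      rw [← whisker_exchange, partialTrace]
      monoidal

lemma traceWith_tensor {X Y Z Z' : C} [ExactPairing X Y] [ExactPairing Z Z']
    (h : X ⊗ Z ⟶ X ⊗ Z) : traceWith (Z' ⊗ Y) h = traceWith Y (partialTrace Z' h) := by
  have key : (β_ (X ⊗ Z) (Z' ⊗ Y)).hom ≫ ε_ (X ⊗ Z) (Z' ⊗ Y) =
      𝟙 _ ⊗≫ X ◁ ((β_ Z Z').hom ≫ ε_ Z Z') ▷ Y ⊗≫ (β_ X Y).hom ≫ ε_ X Y := by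
    set t : X ⊗ Y ⟶ 𝟙_ C := (β_ X Y).hom ≫ ε_ X Y with ht
    have e : (β_ Z Y).hom ≫ (β_ Y Z).hom = 𝟙 _ := SymmetricCategory.symmetry Z Y
    have h1 : 𝟙 (X ⊗ Z ⊗ Y) ⊗≫ X ◁ (β_ Z Y).hom ⊗≫ t ▷ Z ⊗≫ 𝟙 Z =
        𝟙 (X ⊗ Z ⊗ Y) ⊗≫ (β_ X Z).hom ▷ Y ⊗≫ Z ◁ t ⊗≫ 𝟙 Z := by
      calc _ = 𝟙 _ ⊗≫ X ◁ (β_ Z Y).hom ⊗≫ (t ▷ Z ≫ (β_ (𝟙_ C) Z).hom) ⊗≫ 𝟙 Z := by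
            rw [braiding_tensorUnit_left]; monoidal
        _ = 𝟙 _ ⊗≫ X ◁ ((β_ Z Y).hom ≫ (β_ Y Z).hom) ⊗≫ (β_ X Z).hom ▷ Y ⊗≫ Z ◁ t ⊗≫ 𝟙 Z := by
            rw [BraidedCategory.braiding_naturality_left, BraidedCategory.braiding_tensor_left_hom]
            monoidal
        _ = _ := by rw [e]; monoidal
    calc _ = 𝟙 _ ⊗≫ X ◁ (β_ Z Z').hom ▷ Y ⊗≫ (X ◁ Z' ◁ (β_ Z Y).hom ⊗≫
            (β_ X Z').hom ▷ (Y ⊗ Z)) ⊗≫ Z' ◁ t ▷ Z ⊗≫ ε_ Z Z' := by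
          rw [ExactPairing.tensor_evaluation (X₁ := X) (X₂ := Z) (Y₁ := Y) (Y₂ := Z'), BraidedCategory.braiding_tensor_left_hom,
            BraidedCategory.braiding_tensor_right_hom, BraidedCategory.braiding_tensor_right_hom,
            ht]
          monoidal
      _ = 𝟙 _ ⊗≫ X ◁ (β_ Z Z').hom ▷ Y ⊗≫ ((X ⊗ Z') ◁ (β_ Z Y).hom ≫
            (β_ X Z').hom ▷ (Y ⊗ Z)) ⊗≫ Z' ◁ t ▷ Z ⊗≫ ε_ Z Z' := by
          monoidal
      _ = 𝟙 _ ⊗≫ X ◁ (β_ Z Z').hom ▷ Y ⊗≫ (β_ X Z').hom ▷ (Z ⊗ Y) ⊗≫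
            Z' ◁ (𝟙 (X ⊗ Z ⊗ Y) ⊗≫ X ◁ (β_ Z Y).hom ⊗≫ t ▷ Z ⊗≫ 𝟙 Z) ⊗≫ ε_ Z Z' := by
          rw [whisker_exchange]; monoidal
      _ = 𝟙 _ ⊗≫ X ◁ (β_ Z Z').hom ▷ Y ⊗≫ ((α_ X Z' Z).inv ≫ (β_ X Z').hom ▷ Z ≫
            (α_ Z' X Z).hom ≫ Z' ◁ (β_ X Z).hom ≫ (α_ Z' Z X).inv) ▷ Y ⊗≫
            ((Z' ⊗ Z) ◁ t ≫ ε_ Z Z' ▷ 𝟙_ C) ⊗≫ 𝟙 _ := by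
          rw [h1]; monoidal
      _ = 𝟙 _ ⊗≫ X ◁ (β_ Z Z').hom ▷ Y ⊗≫ ((β_ X (Z' ⊗ Z)).hom ≫ ε_ Z Z' ▷ X) ▷ Y ⊗≫
            t ⊗≫ 𝟙 _ := by
          rw [whisker_exchange, ← BraidedCategory.braiding_tensor_right_hom]; monoidal
      _ = _ := by
          rw [← BraidedCategory.braiding_naturality_right, braiding_tensorUnit_right]; monoidal
  rw [traceWith, key, traceWith, partialTrace, ExactPairing.tensor_coevaluation]
  monoidal

variable [RightRigidCategory C]

/-- The categorical trace `𝟙 ⟶ X ⊗ X* ⟶ X ⊗ X* ≅ X* ⊗ X ⟶ 𝟙` (coevaluation, `f ⊗ 1`, symmetry,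
evaluation) of an endomorphism `f` of `X` in a rigid symmetric monoidal category. -/
def catTrace {X : C} (f : X ⟶ X) : 𝟙_ C ⟶ 𝟙_ C :=
  η_ X Xᘁ ≫ f ▷ Xᘁ ≫ (β_ X Xᘁ).hom ≫ ε_ X Xᘁ

lemma catTrace_eq {X : C} (Y : C) [ExactPairing X Y] (f : X ⟶ X) :
    catTrace f = traceWith Y f := by
  have := traceWith_comm (Y := Xᘁ) (Y' := Y) f (𝟙 X)
  rwa [Category.comp_id, Category.id_comp] at this

lemma catTrace_comm {X Y : C} (f : X ⟶ Y) (g : Y ⟶ X) : catTrace (f ≫ g) = catTrace (g ≫ f) :=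
  traceWith_comm f g

lemma catTrace_whiskerRight {X Y Z : C} (f : X ⟶ Y) (g : Y ⊗ Z ⟶ X ⊗ Z) :
    catTrace (g ≫ f ▷ Z) = catTrace (partialTrace Zᘁ g ≫ f) := by
  rw [catTrace_eq (Zᘁ ⊗ Yᘁ), traceWith_tensor, partialTrace_comp]; rfl

variable [Preadditive C] [MonoidalPreadditive C]

/-- A morphism `f : X ⟶ Y` is negligible if `tr (f ∘ g) = 0` for all `g : Y ⟶ X`. -/
def Negligible {X Y : C} (f : X ⟶ Y) : Prop := ∀ g : Y ⟶ X, catTrace (g ≫ f) = 0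

lemma catTrace_zero (X : C) : catTrace (0 : X ⟶ X) = 0 := by simp [catTrace]

lemma catTrace_add {X : C} (f g : X ⟶ X) : catTrace (f + g) = catTrace f + catTrace g := by
  simp [catTrace, MonoidalPreadditive.add_whiskerRight]

lemma catTrace_neg {X : C} (f : X ⟶ X) : catTrace (-f) = -catTrace f := by
  rw [eq_neg_iff_add_eq_zero, ← catTrace_add, neg_add_cancel, catTrace_zero]

namespace Negligible

lemma zero (X Y : C) : Negligible (0 : X ⟶ Y) := fun g => by rw [Limits.comp_zero, catTrace_zero]

lemma add {X Y : C} {f g : X ⟶ Y} (hf : Negligible f) (hg : Negligible g) :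
    Negligible (f + g) := fun k => by
  rw [Preadditive.comp_add, catTrace_add, hf, hg, add_zero]

lemma neg {X Y : C} {f : X ⟶ Y} (hf : Negligible f) : Negligible (-f) := fun k => by
  rw [Preadditive.comp_neg, catTrace_neg, hf, neg_zero]

lemma precomp {X Y Z : C} (f : X ⟶ Y) {g : Y ⟶ Z} (hg : Negligible g) : Negligible (f ≫ g) :=
  fun k => by rw [← Category.assoc, hg]

lemma postcomp {X Y Z : C} {f : X ⟶ Y} (hf : Negligible f) (g : Y ⟶ Z) : Negligible (f ≫ g) :=
  fun k => by rw [← Category.assoc, catTrace_comm, ← Category.assoc, hf]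

lemma whiskerRight {X Y : C} {f : X ⟶ Y} (hf : Negligible f) (Z : C) : Negligible (f ▷ Z) :=
  fun g => by rw [catTrace_whiskerRight, hf]

lemma whiskerLeft {X Y : C} {f : X ⟶ Y} (hf : Negligible f) (Z : C) : Negligible (Z ◁ f) := by
  have h : Z ◁ f = (β_ Z X).hom ≫ f ▷ Z ≫ (β_ Z Y).inv := by
    rw [← BraidedCategory.braiding_naturality_right_assoc, Iso.hom_inv_id, Category.comp_id]
  rw [h]
  exact ((hf.whiskerRight Z).postcomp _).precomp _

lemma smul {k : Type*} [CommRing k] [Linear k C] [MonoidalLinear k C] {X Y : C} {f : X ⟶ Y}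
    (hf : Negligible f) (a : k) : Negligible (a • f) := fun g => by
  have := hf (a • g)
  rwa [Linear.smul_comp, ← Linear.comp_smul] at this

end Negligible

variable (C) in
/-- Two morphisms are identified in the semisimplification if their difference is negligible. -/
def negligibleRel : HomRel C := fun _ _ f g => Negligible (f - g)

instance : Congruence (negligibleRel C) where
  comp_left f g g' h := by
    unfold negligibleRel at *
    rw [← Preadditive.comp_sub]; exact h.precomp f
  comp_right g h := by
    unfold negligibleRel at *
    rw [← Preadditive.sub_comp]; exact h.postcomp g
  equivalence :=
    { refl f := by
        unfold negligibleRel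
        rw [sub_self]; exact .zero _ _
      symm h := by
        unfold negligibleRel at *
        rw [← neg_sub]; exact h.neg
      trans h h' := by
        unfold negligibleRel at *
        rw [← sub_add_sub_cancel]; exact h.add h' }

variable (C) in
/-- The semisimplification `C / N` of `C`: the same objects, and the morphisms of `C` modulo the
negligible ones. -/
abbrev Semisimplification := CategoryTheory.Quotient (negligibleRel C)

namespace Semisimplification

variable (C) in
/-- The semisimplification functor `S : C ⥤ C / N`, i.e. the quotient functor. -/
abbrev functor : C ⥤ Semisimplification C := Quotient.functor (negligibleRel C)

lemma rel_add ⦃X Y : C⦄ (f₁ f₂ g₁ g₂ : X ⟶ Y) (h : negligibleRel C f₁ f₂)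
    (h' : negligibleRel C g₁ g₂) : negligibleRel C (f₁ + g₁) (f₂ + g₂) := by
  unfold negligibleRel at *
  rw [add_sub_add_comm]; exact h.add h'

instance : Preadditive (Semisimplification C) := Quotient.preadditive _ rel_add

instance : (functor C).Additive := Quotient.functor_additive _ rel_add

section
variable (k : Type*) [CommRing k] [Linear k C] [MonoidalLinear k C]

lemma rel_smul (a : k) ⦃X Y : C⦄ (f g : X ⟶ Y) (h : negligibleRel C f g) :
    negligibleRel C (a • f) (a • g) := by
  unfold negligibleRel at *
  rw [← smul_sub]; exact h.smul a

instance : Linear k (Semisimplification C) := Quotient.linear k _ (rel_smul k)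

instance : (functor C).Linear k := Quotient.linear_functor k _ (rel_smul k)
end

lemma map_whiskerLeft_eq (X : C) {Y Z : C} {f g : Y ⟶ Z} (h : (functor C).map f = (functor C).map g) :
    (functor C).map (X ◁ f) = (functor C).map (X ◁ g) := by
  rw [Quotient.functor_map_eq_iff] at h ⊢
  have : Negligible (X ◁ (f - g)) := Negligible.whiskerLeft h X
  have e : X ◁ (f - g) = X ◁ f - X ◁ g := (tensorLeft X).map_sub
  rwa [e] at this

lemma map_whiskerRight_eq (X : C) {Y Z : C} {f g : Y ⟶ Z} (h : (functor C).map f = (functor C).map g) :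
    (functor C).map (f ▷ X) = (functor C).map (g ▷ X) := by
  rw [Quotient.functor_map_eq_iff] at h ⊢
  have : Negligible ((f - g) ▷ X) := Negligible.whiskerRight h X
  have e : (f - g) ▷ X = f ▷ X - g ▷ X := (tensorRight X).map_sub
  rwa [e] at this

end Semisimplification
end Semisimplification

section SemisimplificationMonoidal
universe v u
variable {C : Type u} [Category.{v} C] [MonoidalCategory C] [SymmetricCategory C]
  [RightRigidCategory C] [Preadditive C] [MonoidalPreadditive C]

namespace Semisimplification

/-- The class of `X ◁ f`, for a class `f` of morphisms modulo negligible ones. -/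
def homWhiskerLeft (X : C) {Y Z : C} (f : (functor C).obj Y ⟶ (functor C).obj Z) :
    (functor C).obj (X ⊗ Y) ⟶ (functor C).obj (X ⊗ Z) :=
  Quot.lift (fun g : Y ⟶ Z => (functor C).map (X ◁ g))
    (fun _ _ h => map_whiskerLeft_eq X (Quot.sound h)) f

/-- The class of `f ▷ X`, for a class `f` of morphisms modulo negligible ones. -/
def homWhiskerRight {Y Z : C} (f : (functor C).obj Y ⟶ (functor C).obj Z) (X : C) :
    (functor C).obj (Y ⊗ X) ⟶ (functor C).obj (Z ⊗ X) :=
  Quot.lift (fun g : Y ⟶ Z => (functor C).map (g ▷ X))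
    (fun _ _ h => map_whiskerRight_eq X (Quot.sound h)) f

lemma exists_map {X Y : Semisimplification C} (f : X ⟶ Y) :
    ∃ g : X.as ⟶ Y.as, f = (functor C).map g := by
  obtain ⟨g, rfl⟩ := (functor C).map_surjective (X := X.as) (Y := Y.as) f
  exact ⟨g, rfl⟩

/-- The tensor product of the semisimplification: that of `C` on objects and representatives. -/
instance : MonoidalCategoryStruct (Semisimplification C) where
  tensorObj X Y := (functor C).obj (X.as ⊗ Y.as)
  tensorUnit := (functor C).obj (𝟙_ C)
  whiskerLeft X _ _ f := homWhiskerLeft X.as f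
  whiskerRight f X := homWhiskerRight f X.as
  tensorHom {_ Y X' _} f g := homWhiskerRight f X'.as ≫ homWhiskerLeft Y.as g
  associator X Y Z := (functor C).mapIso (α_ X.as Y.as Z.as)
  leftUnitor X := (functor C).mapIso (λ_ X.as)
  rightUnitor X := (functor C).mapIso (ρ_ X.as)

lemma whiskerLeft_map (X : C) {Y Z : C} (f : Y ⟶ Z) :
    (functor C).obj X ◁ (functor C).map f = (functor C).map (X ◁ f) := rfl

lemma map_whiskerRight' {Y Z : C} (f : Y ⟶ Z) (X : C) :
    (functor C).map f ▷ (functor C).obj X = (functor C).map (f ▷ X) := rfl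

lemma tensorHom_map {X Y X' Y' : C} (f : X ⟶ Y) (g : X' ⟶ Y') :
    (functor C).map f ⊗ₘ (functor C).map g = (functor C).map (f ⊗ₘ g) :=
  (congrArg (functor C).map (MonoidalCategory.tensorHom_def f g)).symm

instance : MonoidalCategory (Semisimplification C) where
  tensorHom_def _ _ := rfl
  id_tensorHom_id X Y := congrArg (functor C).map
    ((MonoidalCategory.tensorHom_def _ _).symm.trans (MonoidalCategory.id_tensorHom_id X.as Y.as))
  tensorHom_comp_tensorHom f₁ f₂ g₁ g₂ := by
    obtain ⟨f₁, rfl⟩ := exists_map f₁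
    obtain ⟨f₂, rfl⟩ := exists_map f₂
    obtain ⟨g₁, rfl⟩ := exists_map g₁
    obtain ⟨g₂, rfl⟩ := exists_map g₂
    have := congrArg (functor C).map (MonoidalCategory.tensorHom_comp_tensorHom f₁ f₂ g₁ g₂)
    rw [Functor.map_comp, ← tensorHom_map, ← tensorHom_map, ← tensorHom_map] at this
    exact this
  whiskerLeft_id X Y := congrArg (functor C).map (MonoidalCategory.whiskerLeft_id X.as Y.as)
  id_whiskerRight X Y := congrArg (functor C).map (MonoidalCategory.id_whiskerRight X.as Y.as)
  associator_naturality f₁ f₂ f₃ := by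
    obtain ⟨f₁, rfl⟩ := exists_map f₁
    obtain ⟨f₂, rfl⟩ := exists_map f₂
    obtain ⟨f₃, rfl⟩ := exists_map f₃
    have := congrArg (functor C).map (MonoidalCategory.associator_naturality f₁ f₂ f₃)
    rw [Functor.map_comp, Functor.map_comp, ← tensorHom_map, ← tensorHom_map, ← tensorHom_map,
      ← tensorHom_map] at this
    exact this
  leftUnitor_naturality f := by
    obtain ⟨f, rfl⟩ := exists_map f
    exact congrArg (functor C).map (MonoidalCategory.leftUnitor_naturality f)
  rightUnitor_naturality f := by
    obtain ⟨f, rfl⟩ := exists_map f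
    exact congrArg (functor C).map (MonoidalCategory.rightUnitor_naturality f)
  pentagon W X Y Z := congrArg (functor C).map
    (MonoidalCategory.pentagon W.as X.as Y.as Z.as)
  triangle X Y := congrArg (functor C).map (MonoidalCategory.triangle X.as Y.as)

instance : BraidedCategory (Semisimplification C) where
  braiding X Y := (functor C).mapIso (β_ X.as Y.as)
  braiding_naturality_right X _ _ f := by
    obtain ⟨f, rfl⟩ := exists_map f
    exact congrArg (functor C).map (BraidedCategory.braiding_naturality_right X.as f)
  braiding_naturality_left f Z := by
    obtain ⟨f, rfl⟩ := exists_map f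
    exact congrArg (functor C).map (BraidedCategory.braiding_naturality_left f Z.as)
  hexagon_forward X Y Z := congrArg (functor C).map
    (BraidedCategory.hexagon_forward X.as Y.as Z.as)
  hexagon_reverse X Y Z := congrArg (functor C).map
    (BraidedCategory.hexagon_reverse X.as Y.as Z.as)

instance : SymmetricCategory (Semisimplification C) where
  symmetry X Y := congrArg (functor C).map (SymmetricCategory.symmetry X.as Y.as)

instance : (functor C).Monoidal :=
  Functor.CoreMonoidal.toMonoidal
    { εIso := Iso.refl _
      μIso := fun _ _ => Iso.refl _
      μIso_hom_natural_left := fun f Z => by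
        simp [map_whiskerRight']
      μIso_hom_natural_right := fun f Z => by
        simp [whiskerLeft_map]
      associativity := fun X Y Z => by
        simp only [Iso.refl_hom, MonoidalCategory.id_whiskerRight, Category.id_comp,
          MonoidalCategory.whiskerLeft_id, Category.comp_id]
        rfl
      left_unitality := fun X => by
        simp only [Iso.refl_hom, MonoidalCategory.id_whiskerRight, Category.id_comp]
        rfl
      right_unitality := fun X => by
        simp only [Iso.refl_hom, MonoidalCategory.whiskerLeft_id, Category.id_comp]
        rfl }

instance : (functor C).Braided where
  braided _ _ := (Category.id_comp _).trans (Category.comp_id _).symm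

end Semisimplification
end SemisimplificationMonoidal

section ComodDefs
universe v u
variable {C : Type u} [Category.{v} C] [MonoidalCategory C]

/-- A right comodule over a comonoid object `A` (e.g. a coalgebra). -/
structure Comod (A : C) [ComonObj A] where
  X : C
  coact : X ⟶ X ⊗ A
  coact_counit : coact ≫ X ◁ ε[A] = (ρ_ X).inv
  coact_comul : coact ≫ X ◁ Δ[A] = coact ≫ coact ▷ A ≫ (α_ X A A).hom

namespace Comod

section Cat
variable {A : C} [ComonObj A]

/-- A morphism of comodules. -/
@[ext]
structure Hom (M N : Comod A) where
  hom : M.X ⟶ N.X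
  comm : M.coact ≫ hom ▷ A = hom ≫ N.coact

instance : Category (Comod A) where
  Hom := Hom
  id M := ⟨𝟙 M.X, by simp⟩
  comp f g := ⟨f.hom ≫ g.hom, by
    rw [comp_whiskerRight, reassoc_of% (Hom.comm f), Hom.comm g, Category.assoc]⟩

@[ext]
lemma hom_ext {M N : Comod A} {f g : M ⟶ N} (h : f.hom = g.hom) : f = g := by
  exact Hom.ext h

@[simp] lemma id_hom (M : Comod A) : (𝟙 M : M ⟶ M).hom = 𝟙 M.X := rfl
@[simp] lemma comp_hom {M N P : Comod A} (f : M ⟶ N) (g : N ⟶ P) :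
    (f ≫ g).hom = f.hom ≫ g.hom := rfl

@[simps]
def mkIso {M N : Comod A} (e : M.X ≅ N.X) (h : M.coact ≫ e.hom ▷ A = e.hom ≫ N.coact) :
    M ≅ N where
  hom := ⟨e.hom, h⟩
  inv := ⟨e.inv, by
    rw [← cancel_epi e.hom, ← reassoc_of% h, hom_inv_whiskerRight]; simp⟩
  hom_inv_id := hom_ext e.hom_inv_id
  inv_hom_id := hom_ext e.inv_hom_id

end Cat

section Monoidal
variable [BraidedCategory C] {A : C} [BimonObj A]

/-- The diagonal coaction on a tensor product,
`x ⊗ y ↦ ± (x₀ ⊗ y₀) ⊗ x₁ y₁`, the sign being that of the braiding. -/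
def tensorCoact {X Y : C} (a : X ⟶ X ⊗ A) (b : Y ⟶ Y ⊗ A) : X ⊗ Y ⟶ (X ⊗ Y) ⊗ A :=
  (a ⊗ₘ b) ≫ tensorμ X A Y A ≫ (X ⊗ Y) ◁ μ[A]

lemma tensorCoact_naturality {X Y X' Y' : C} (a : X ⟶ X ⊗ A) (b : Y ⟶ Y ⊗ A)
    (a' : X' ⟶ X' ⊗ A) (b' : Y' ⟶ Y' ⊗ A) (f : X ⟶ X') (g : Y ⟶ Y')
    (hf : a ≫ f ▷ A = f ≫ a') (hg : b ≫ g ▷ A = g ≫ b') :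
    tensorCoact a b ≫ (f ⊗ₘ g) ▷ A = (f ⊗ₘ g) ≫ tensorCoact a' b' := by
  have h : (f ⊗ₘ g) ≫ (a' ⊗ₘ b') = (a ⊗ₘ b) ≫ ((f ⊗ₘ 𝟙 A) ⊗ₘ (g ⊗ₘ 𝟙 A)) := by
    simp only [tensorHom_id, tensorHom_comp_tensorHom, hf, hg]
  simp only [tensorCoact, Category.assoc]
  rw [reassoc_of% h, tensorμ_natural_assoc, whisker_exchange]
  simp only [MonoidalCategory.tensorHom_id, MonoidalCategory.id_whiskerRight]

lemma tensorCoact_counit (M N : Comod A) :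
    tensorCoact M.coact N.coact ≫ (M.X ⊗ N.X) ◁ ε[A] = (ρ_ _).inv := by
  have h : (M.coact ⊗ₘ N.coact) ≫ ((𝟙 M.X ⊗ₘ ε[A]) ⊗ₘ (𝟙 N.X ⊗ₘ ε[A])) =
      ((ρ_ M.X).inv ⊗ₘ (ρ_ N.X).inv) := by
    simp only [id_tensorHom, tensorHom_comp_tensorHom, M.coact_counit, N.coact_counit]
  have h2 := tensorμ_natural (𝟙 M.X) ε[A] (𝟙 N.X) ε[A]
  simp only [tensorCoact, Category.assoc, ← MonoidalCategory.whiskerLeft_comp, Bimon.mul_counit]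
  rw [MonoidalCategory.whiskerLeft_comp, ← MonoidalCategory.id_tensorHom,
    ← MonoidalCategory.id_tensorHom_id, ← reassoc_of% h2, reassoc_of% h]
  have h3 := rightUnitor_monoidal M.X N.X
  rw [← cancel_mono (ρ_ (M.X ⊗ N.X)).hom, Category.assoc, Category.assoc, ← h3,
    tensorHom_comp_tensorHom, Iso.inv_hom_id, Iso.inv_hom_id, Iso.inv_hom_id, id_tensorHom_id]

lemma tensorCoact_comul (M N : Comod A) :
    tensorCoact M.coact N.coact ≫ (M.X ⊗ N.X) ◁ Δ[A] =
      tensorCoact M.coact N.coact ≫ tensorCoact M.coact N.coact ▷ A ≫ (α_ _ A A).hom := by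
  have h2 := tensorμ_natural (𝟙 M.X) Δ[A] (𝟙 N.X) Δ[A]
  have h3 := tensorμ_natural M.coact (𝟙 A) N.coact (𝟙 A)
  have h4 := associator_monoidal M.X A A N.X A A
  have h5 : (M.coact ⊗ₘ N.coact) ≫ ((𝟙 M.X ⊗ₘ Δ[A]) ⊗ₘ (𝟙 N.X ⊗ₘ Δ[A])) =
      (M.coact ⊗ₘ N.coact) ≫ ((M.coact ⊗ₘ 𝟙 A) ⊗ₘ (N.coact ⊗ₘ 𝟙 A)) ≫
        ((α_ M.X A A).hom ⊗ₘ (α_ N.X A A).hom) := by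
    simp only [id_tensorHom, tensorHom_id, tensorHom_comp_tensorHom, M.coact_comul, N.coact_comul]
  have L : tensorCoact M.coact N.coact ≫ (M.X ⊗ N.X) ◁ Δ[A] =
      (M.coact ⊗ₘ N.coact) ≫ tensorμ M.X A N.X A ≫
        ((𝟙 M.X ⊗ₘ 𝟙 N.X) ⊗ₘ (Δ[A] ⊗ₘ Δ[A])) ≫ (M.X ⊗ N.X) ◁ tensorμ A A A A ≫
          (M.X ⊗ N.X) ◁ (μ[A] ⊗ₘ μ[A]) := by
    rw [id_tensorHom_id, id_tensorHom]
    simp only [tensorCoact, Category.assoc, ← MonoidalCategory.whiskerLeft_comp,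
      BimonObj.mul_comul]
  have R : tensorCoact M.coact N.coact ≫ tensorCoact M.coact N.coact ▷ A ≫ (α_ _ A A).hom =
      (M.coact ⊗ₘ N.coact) ≫ tensorμ M.X A N.X A ≫
        ((M.coact ⊗ₘ N.coact) ⊗ₘ (𝟙 A ⊗ₘ 𝟙 A)) ≫ tensorμ M.X A N.X A ▷ (A ⊗ A) ≫
          (α_ _ _ _).hom ≫ (M.X ⊗ N.X) ◁ (μ[A] ⊗ₘ μ[A]) := by
    rw [id_tensorHom_id, tensorHom_id, MonoidalCategory.tensorHom_def' μ[A] μ[A]]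
    simp only [tensorCoact, Category.assoc, comp_whiskerRight, MonoidalCategory.whiskerLeft_comp]
    rw [whisker_exchange_assoc, whisker_exchange_assoc]
    monoidal
  rw [L, R, ← reassoc_of% h2, reassoc_of% h5, ← reassoc_of% h3, reassoc_of% h4]

lemma tensorCoact_assoc {X Y Z : C} (a : X ⟶ X ⊗ A) (b : Y ⟶ Y ⊗ A) (c : Z ⟶ Z ⊗ A) :
    tensorCoact (tensorCoact a b) c ≫ (α_ X Y Z).hom ▷ A =
      (α_ X Y Z).hom ≫ tensorCoact a (tensorCoact b c) := by
  have h2 := tensorμ_natural (𝟙 (X ⊗ Y)) μ[A] (𝟙 Z) (𝟙 A)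
  have h3 := tensorμ_natural (𝟙 X) (𝟙 A) (𝟙 (Y ⊗ Z)) μ[A]
  have h4 := tensor_associativity X A Y A Z A
  have L : tensorCoact (tensorCoact a b) c =
      ((a ⊗ₘ b) ⊗ₘ c) ≫ (tensorμ X A Y A ▷ (Z ⊗ A)) ≫
        ((𝟙 (X ⊗ Y) ⊗ₘ μ[A]) ⊗ₘ (𝟙 Z ⊗ₘ 𝟙 A)) ≫ tensorμ (X ⊗ Y) A Z A ≫ _ ◁ μ[A] := by
    simp only [tensorCoact, id_tensorHom, ← tensorHom_id, tensorHom_comp_tensorHom_assoc,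
      MonoidalCategory.whiskerLeft_id, Category.comp_id]
  have R : tensorCoact a (tensorCoact b c) =
      (a ⊗ₘ (b ⊗ₘ c)) ≫ ((X ⊗ A) ◁ tensorμ Y A Z A) ≫
        ((𝟙 X ⊗ₘ 𝟙 A) ⊗ₘ (𝟙 (Y ⊗ Z) ⊗ₘ μ[A])) ≫ tensorμ X A (Y ⊗ Z) A ≫ _ ◁ μ[A] := by
    simp only [tensorCoact, ← id_tensorHom, tensorHom_comp_tensorHom_assoc,
      Category.comp_id, id_tensorHom_id]
  have h5 : ((𝟙 X ⊗ₘ 𝟙 Y) ⊗ₘ 𝟙 Z) = 𝟙 _ := by simp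
  have h6 : ((𝟙 (X ⊗ Y) ⊗ₘ 𝟙 Z) ⊗ₘ (μ[A] ⊗ₘ 𝟙 A)) ≫ ((X ⊗ Y) ⊗ Z) ◁ μ[A] ≫ (α_ X Y Z).hom ▷ A =
      ((α_ X Y Z).hom ⊗ₘ (α_ A A A).hom) ≫ ((𝟙 X ⊗ₘ 𝟙 (Y ⊗ Z)) ⊗ₘ (𝟙 A ⊗ₘ μ[A])) ≫
        (X ⊗ Y ⊗ Z) ◁ μ[A] := by
    rw [id_tensorHom_id, id_tensorHom_id, id_tensorHom, id_tensorHom, id_tensorHom, tensorHom_id,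
      ← MonoidalCategory.whiskerLeft_comp_assoc, MonObj.mul_assoc, MonoidalCategory.tensorHom_def',
      MonoidalCategory.whiskerLeft_comp, MonoidalCategory.whiskerLeft_comp]
    simp only [Category.assoc, whisker_exchange, whisker_exchange_assoc]
  rw [L, R]
  simp only [Category.assoc]
  rw [reassoc_of% h2, reassoc_of% h3, h6, reassoc_of% h4, associator_naturality_assoc]

lemma tensorCoact_left {X : C} (a : X ⟶ X ⊗ A) :
    tensorCoact ((λ_ (𝟙_ C)).inv ≫ 𝟙_ C ◁ η[A]) a ≫ (λ_ X).hom ▷ A = (λ_ X).hom ≫ a := by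
  have h1 : (((λ_ (𝟙_ C)).inv ≫ 𝟙_ C ◁ η[A]) ⊗ₘ a) =
      𝟙_ C ◁ a ≫ (λ_ (𝟙_ C)).inv ▷ (X ⊗ A) ≫ ((𝟙 _ ⊗ₘ η[A]) ⊗ₘ (𝟙 X ⊗ₘ 𝟙 A)) := by
    rw [id_tensorHom_id, tensorHom_id, id_tensorHom, ← comp_whiskerRight, MonoidalCategory.tensorHom_def']
  have h2 := tensorμ_natural (𝟙 (𝟙_ C)) η[A] (𝟙 X) (𝟙 A)
  have h3 : ((𝟙 (𝟙_ C) ⊗ₘ 𝟙 X) ⊗ₘ (η[A] ⊗ₘ 𝟙 A)) ≫ (𝟙_ C ⊗ X) ◁ μ[A] ≫ (λ_ X).hom ▷ A =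
      ((λ_ X).hom ⊗ₘ (λ_ A).hom) := by
    rw [id_tensorHom_id, id_tensorHom, tensorHom_id, ← MonoidalCategory.whiskerLeft_comp_assoc,
      MonObj.one_mul, MonoidalCategory.tensorHom_def']
  have h4 := tensor_left_unitality X A
  simp only [tensorCoact, Category.assoc]
  rw [h1]
  simp only [Category.assoc]
  rw [reassoc_of% h2, h3, ← h4, leftUnitor_naturality]

lemma tensorCoact_right {X : C} (a : X ⟶ X ⊗ A) :
    tensorCoact a ((λ_ (𝟙_ C)).inv ≫ 𝟙_ C ◁ η[A]) ≫ (ρ_ X).hom ▷ A = (ρ_ X).hom ≫ a := by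
  have h1 : (a ⊗ₘ ((λ_ (𝟙_ C)).inv ≫ 𝟙_ C ◁ η[A])) =
      a ▷ 𝟙_ C ≫ (X ⊗ A) ◁ (λ_ (𝟙_ C)).inv ≫ ((𝟙 X ⊗ₘ 𝟙 A) ⊗ₘ (𝟙 _ ⊗ₘ η[A])) := by
    rw [id_tensorHom_id, id_tensorHom, id_tensorHom, ← MonoidalCategory.whiskerLeft_comp,
      MonoidalCategory.tensorHom_def]
  have h2 := tensorμ_natural (𝟙 X) (𝟙 A) (𝟙 (𝟙_ C)) η[A]
  have h3 : ((𝟙 X ⊗ₘ 𝟙 (𝟙_ C)) ⊗ₘ (𝟙 A ⊗ₘ η[A])) ≫ (X ⊗ 𝟙_ C) ◁ μ[A] ≫ (ρ_ X).hom ▷ A =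
      ((ρ_ X).hom ⊗ₘ (ρ_ A).hom) := by
    rw [id_tensorHom_id, id_tensorHom, id_tensorHom, ← MonoidalCategory.whiskerLeft_comp_assoc,
      MonObj.mul_one, MonoidalCategory.tensorHom_def']
  have h4 := tensor_right_unitality X A
  simp only [tensorCoact, Category.assoc]
  rw [h1]
  simp only [Category.assoc]
  rw [reassoc_of% h2, h3, ← h4, rightUnitor_naturality]

lemma unitCoact_comul : ((λ_ (𝟙_ C)).inv ≫ 𝟙_ C ◁ η[A]) ≫ 𝟙_ C ◁ Δ[A] =
    ((λ_ (𝟙_ C)).inv ≫ 𝟙_ C ◁ η[A]) ≫ ((λ_ (𝟙_ C)).inv ≫ 𝟙_ C ◁ η[A]) ▷ A ≫ (α_ _ A A).hom := by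
  rw [Category.assoc, ← MonoidalCategory.whiskerLeft_comp, Bimon.one_comul, comp_whiskerRight,
    tensorHom_def']
  simp only [Category.assoc]
  rw [whisker_exchange_assoc]
  simp only [← Category.assoc]
  monoidal

/-- The tensor product of comodules over a bimonoid; the unit is the trivial comodule. -/
instance : MonoidalCategoryStruct (Comod A) where
  tensorObj M N := ⟨M.X ⊗ N.X, tensorCoact M.coact N.coact, tensorCoact_counit M N,
    tensorCoact_comul M N⟩
  tensorUnit := ⟨𝟙_ C, (λ_ (𝟙_ C)).inv ≫ 𝟙_ C ◁ η[A], by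
      rw [Category.assoc, ← MonoidalCategory.whiskerLeft_comp, BimonObj.one_counit]
      simp [unitors_inv_equal], unitCoact_comul⟩
  whiskerLeft M _ _ f := ⟨M.X ◁ f.hom, by
    have := tensorCoact_naturality (A := A) M.coact _ M.coact _ (𝟙 M.X) f.hom (by simp) (Hom.comm f)
    rw [id_tensorHom] at this
    exact this⟩
  whiskerRight f N := ⟨f.hom ▷ N.X, by
    have := tensorCoact_naturality (A := A) _ N.coact _ N.coact f.hom (𝟙 N.X) (Hom.comm f) (by simp)
    rw [tensorHom_id] at this
    exact this⟩
  tensorHom f g := ⟨f.hom ⊗ₘ g.hom, tensorCoact_naturality _ _ _ _ _ _ (Hom.comm f) (Hom.comm g)⟩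
  associator M N P := mkIso (α_ M.X N.X P.X) (tensorCoact_assoc _ _ _)
  leftUnitor M := mkIso (λ_ M.X) (tensorCoact_left _)
  rightUnitor M := mkIso (ρ_ M.X) (tensorCoact_right _)

instance : MonoidalCategory (Comod A) where
  tensorHom_def _ _ := hom_ext (MonoidalCategory.tensorHom_def _ _)
  id_tensorHom_id _ _ := hom_ext (MonoidalCategory.id_tensorHom_id _ _)
  tensorHom_comp_tensorHom _ _ _ _ := hom_ext (MonoidalCategory.tensorHom_comp_tensorHom _ _ _ _)
  whiskerLeft_id _ _ := hom_ext (MonoidalCategory.whiskerLeft_id _ _)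
  id_whiskerRight _ _ := hom_ext (MonoidalCategory.id_whiskerRight _ _)
  associator_naturality _ _ _ := hom_ext (MonoidalCategory.associator_naturality _ _ _)
  leftUnitor_naturality _ := hom_ext (MonoidalCategory.leftUnitor_naturality _)
  rightUnitor_naturality _ := hom_ext (MonoidalCategory.rightUnitor_naturality _)
  pentagon _ _ _ _ := hom_ext (MonoidalCategory.pentagon _ _ _ _)
  triangle _ _ := hom_ext (MonoidalCategory.triangle _ _)

end Monoidal

lemma tensorμ_braiding [SymmetricCategory C] (X A Y B : C) :
    tensorμ X A Y B ≫ ((β_ X Y).hom ⊗ₘ (β_ A B).hom) =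
      (β_ (X ⊗ A) (Y ⊗ B)).hom ≫ tensorμ Y B X A := by
  have e : (β_ X B).hom ≫ (β_ B X).hom = 𝟙 _ := SymmetricCategory.symmetry X B
  calc
    _ = 𝟙 _ ⊗≫ X ◁ (β_ A Y).hom ▷ B ⊗≫
        ((X ⊗ Y) ◁ (β_ A B).hom ≫ (β_ X Y).hom ▷ (B ⊗ A)) ⊗≫
        Y ◁ (𝟙 (X ⊗ B)) ▷ A ⊗≫ 𝟙 _ := by
      rw [tensorHom_def', tensorμ]; monoidal
    _ = _ := by
      rw [whisker_exchange, ← e, tensorμ, BraidedCategory.braiding_tensor_right_hom,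
        BraidedCategory.braiding_tensor_left_hom, BraidedCategory.braiding_tensor_left_hom]
      monoidal

section Symm
variable [SymmetricCategory C] {A : C} [BimonObj A] [IsCommMonObj A]

lemma tensorCoact_braid {X Y : C} (a : X ⟶ X ⊗ A) (b : Y ⟶ Y ⊗ A) :
    tensorCoact a b ≫ (β_ X Y).hom ▷ A = (β_ X Y).hom ≫ tensorCoact b a := by
  have h : (X ⊗ Y) ◁ μ[A] ≫ (β_ X Y).hom ▷ A =
      ((β_ X Y).hom ⊗ₘ (β_ A A).hom) ≫ (Y ⊗ X) ◁ μ[A] := by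
    rw [MonoidalCategory.tensorHom_def, Category.assoc, ← MonoidalCategory.whiskerLeft_comp,
      IsCommMonObj.mul_comm, whisker_exchange]
  simp only [tensorCoact, Category.assoc]
  rw [h, reassoc_of% (tensorμ_braiding X A Y A), BraidedCategory.braiding_naturality_assoc]

instance : BraidedCategory (Comod A) where
  braiding M N := mkIso (β_ M.X N.X) (tensorCoact_braid _ _)
  braiding_naturality_right _ _ _ _ := hom_ext (BraidedCategory.braiding_naturality_right _ _)
  braiding_naturality_left _ _ := hom_ext (BraidedCategory.braiding_naturality_left _ _)
  hexagon_forward _ _ _ := hom_ext (BraidedCategory.hexagon_forward _ _ _)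
  hexagon_reverse _ _ _ := hom_ext (BraidedCategory.hexagon_reverse _ _ _)

instance : SymmetricCategory (Comod A) where
  symmetry _ _ := hom_ext (SymmetricCategory.symmetry _ _)

end Symm

end Comod
end ComodDefs

section ComodLinear
universe v u
variable {C : Type u} [Category.{v} C] [MonoidalCategory C] [Preadditive C] [MonoidalPreadditive C]

namespace Comod

section
variable {A : C} [ComonObj A]

instance (M N : Comod A) : Add (M ⟶ N) := ⟨fun f g => ⟨f.hom + g.hom, by
  rw [MonoidalPreadditive.add_whiskerRight, Preadditive.comp_add, Preadditive.add_comp,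
    Hom.comm f, Hom.comm g]⟩⟩

instance (M N : Comod A) : Zero (M ⟶ N) := ⟨⟨0, by simp⟩⟩

instance (M N : Comod A) : Neg (M ⟶ N) := ⟨fun f => ⟨-f.hom, by
  have h : (-f.hom) ▷ A = -(f.hom ▷ A) := (tensorRight A).map_neg
  rw [h, Preadditive.comp_neg, Preadditive.neg_comp, Hom.comm f]⟩⟩

instance (M N : Comod A) : Sub (M ⟶ N) := ⟨fun f g => ⟨f.hom - g.hom, by
  have h : (f.hom - g.hom) ▷ A = f.hom ▷ A - g.hom ▷ A := (tensorRight A).map_sub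
  rw [h, Preadditive.comp_sub, Preadditive.sub_comp, Hom.comm f, Hom.comm g]⟩⟩

instance (M N : Comod A) : SMul ℕ (M ⟶ N) := ⟨fun c f => ⟨c • f.hom, by
  have h : (c • f.hom) ▷ A = c • (f.hom ▷ A) := (tensorRight A).map_nsmul
  rw [h, Preadditive.comp_nsmul, Preadditive.nsmul_comp, Hom.comm f]⟩⟩

instance (M N : Comod A) : SMul ℤ (M ⟶ N) := ⟨fun c f => ⟨c • f.hom, by
  have h : (c • f.hom) ▷ A = c • (f.hom ▷ A) := (tensorRight A).map_zsmul
  rw [h, Preadditive.comp_zsmul, Preadditive.zsmul_comp, Hom.comm f]⟩⟩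

lemma hom_injective (M N : Comod A) : Function.Injective (fun f : M ⟶ N => f.hom) :=
  fun _ _ h => hom_ext h

instance (M N : Comod A) : AddCommGroup (M ⟶ N) :=
  (hom_injective M N).addCommGroup _ rfl (fun _ _ => rfl) (fun _ => rfl) (fun _ _ => rfl)
    (fun _ _ => rfl) (fun _ _ => rfl)

instance : Preadditive (Comod A) where
  add_comp _ _ _ _ _ _ := hom_ext (Preadditive.add_comp _ _ _ _ _ _)
  comp_add _ _ _ _ _ _ := hom_ext (Preadditive.comp_add _ _ _ _ _ _)

variable (k : Type*) [CommRing k] [Linear k C] [MonoidalLinear k C]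

instance (M N : Comod A) : SMul k (M ⟶ N) := ⟨fun c f => ⟨c • f.hom, by
  rw [MonoidalLinear.smul_whiskerRight, Linear.comp_smul, Linear.smul_comp, Hom.comm f]⟩⟩

instance (M N : Comod A) : Module k (M ⟶ N) :=
  (hom_injective M N).module k ⟨⟨fun f => f.hom, rfl⟩, fun _ _ => rfl⟩ (fun _ _ => rfl)

instance : Linear k (Comod A) where
  smul_comp _ _ _ _ _ _ := hom_ext (Linear.smul_comp _ _ _ _ _ _)
  comp_smul _ _ _ _ _ _ := hom_ext (Linear.comp_smul _ _ _ _ _ _)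

end

section
variable [BraidedCategory C] {A : C} [BimonObj A]

instance : MonoidalPreadditive (Comod A) where
  whiskerLeft_zero := hom_ext (MonoidalPreadditive.whiskerLeft_zero)
  zero_whiskerRight := hom_ext (MonoidalPreadditive.zero_whiskerRight)
  whiskerLeft_add _ _ := hom_ext (MonoidalPreadditive.whiskerLeft_add _ _)
  add_whiskerRight _ _ := hom_ext (MonoidalPreadditive.add_whiskerRight _ _)

instance (k : Type*) [CommRing k] [Linear k C] [MonoidalLinear k C] :
    MonoidalLinear k (Comod A) where
  whiskerLeft_smul _ _ _ _ _ := hom_ext (MonoidalLinear.whiskerLeft_smul _ _ _)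
  smul_whiskerRight _ _ _ _ _ := hom_ext (MonoidalLinear.smul_whiskerRight _ _ _)

end

end Comod
end ComodLinear

section ComodDual
universe v u
variable {C : Type u} [Category.{v} C] [MonoidalCategory C]

namespace Comod

section Planar
variable {X Y : C} [ExactPairing X Y]

lemma mate_injective {Z : C} {f g : Y ⟶ Z} (h : η_ X Y ≫ X ◁ f = η_ X Y ≫ X ◁ g) : f = g := by
  have key : ∀ k : Y ⟶ Z, k = (ρ_ Y).inv ≫ Y ◁ (η_ X Y ≫ X ◁ k) ≫ (α_ Y X Z).inv ≫
      ε_ X Y ▷ Z ≫ (λ_ Z).hom := by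
    intro k
    symm
    calc _ = (ρ_ Y).inv ≫ Y ◁ η_ X Y ≫ (α_ Y X Y).inv ≫ ((Y ⊗ X) ◁ k ≫ ε_ X Y ▷ Z) ≫
          (λ_ Z).hom := by monoidal
      _ = (ρ_ Y).inv ≫ (Y ◁ η_ X Y ≫ (α_ Y X Y).inv ≫ ε_ X Y ▷ Y) ≫ 𝟙_ C ◁ k ≫
          (λ_ Z).hom := by rw [whisker_exchange]; simp only [Category.assoc]
      _ = k := by rw [ExactPairing.coevaluation_evaluation]; simp
  rw [key f, key g, h]

/-- The left coaction on the dual `Y` of `X` that is the transpose of a right coaction on `X`. -/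
def dualLeftCoact {A : C} (r : X ⟶ X ⊗ A) : Y ⟶ A ⊗ Y :=
  (ρ_ Y).inv ≫ Y ◁ (η_ X Y ≫ r ▷ Y ≫ (α_ X A Y).hom) ≫ (α_ Y X (A ⊗ Y)).inv ≫
    ε_ X Y ▷ (A ⊗ Y) ≫ (λ_ (A ⊗ Y)).hom

variable {A : C} (r : X ⟶ X ⊗ A)

lemma coev_dualLeftCoact : η_ X Y ≫ X ◁ dualLeftCoact (Y := Y) r =
    η_ X Y ≫ r ▷ Y ≫ (α_ X A Y).hom := by
  calc _ = 𝟙 _ ⊗≫ (η_ X Y ▷ 𝟙_ C ≫ (X ⊗ Y) ◁ (η_ X Y ≫ r ▷ Y ≫ (α_ X A Y).hom)) ⊗≫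
          X ◁ ε_ X Y ▷ (A ⊗ Y) ⊗≫ 𝟙 _ := by
        rw [dualLeftCoact]; monoidal
    _ = 𝟙 _ ⊗≫ (η_ X Y ≫ r ▷ Y ≫ (α_ X A Y).hom) ⊗≫
          (η_ X Y ▷ X ⊗≫ X ◁ ε_ X Y) ▷ (A ⊗ Y) ⊗≫ 𝟙 _ := by
        rw [← whisker_exchange]; monoidal
    _ = _ := by
        rw [ExactPairing.evaluation_coevaluation'']; monoidal

lemma dualLeftCoact_ev : dualLeftCoact (Y := Y) r ▷ X ≫ (α_ A Y X).hom ≫ A ◁ ε_ X Y ≫ (ρ_ A).hom =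
    Y ◁ r ≫ (α_ Y X A).inv ≫ ε_ X Y ▷ A ≫ (λ_ A).hom := by
  calc _ = 𝟙 _ ⊗≫ Y ◁ η_ X Y ▷ X ⊗≫ Y ◁ r ▷ (Y ⊗ X) ⊗≫
          (ε_ X Y ▷ (A ⊗ Y ⊗ X) ≫ 𝟙_ C ◁ A ◁ ε_ X Y) ⊗≫ 𝟙 _ := by
        rw [dualLeftCoact]; monoidal
    _ = 𝟙 _ ⊗≫ Y ◁ η_ X Y ▷ X ⊗≫ Y ◁ (r ▷ (Y ⊗ X) ≫ (X ⊗ A) ◁ ε_ X Y) ⊗≫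
          ε_ X Y ▷ A ⊗≫ 𝟙 _ := by
        rw [← whisker_exchange]; monoidal
    _ = 𝟙 _ ⊗≫ Y ◁ (η_ X Y ▷ X ⊗≫ X ◁ ε_ X Y) ⊗≫ Y ◁ r ⊗≫
          ε_ X Y ▷ A ⊗≫ 𝟙 _ := by
        rw [← whisker_exchange]; monoidal
    _ = _ := by
        rw [ExactPairing.evaluation_coevaluation'']; monoidal

end Planar

section
variable {A : C} [ComonObj A] (M : Comod A) (Y : C) [ExactPairing M.X Y]

lemma dualLeftCoact_counit : dualLeftCoact (Y := Y) M.coact ≫ ε[A] ▷ Y = (λ_ Y).inv := by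
  apply mate_injective (X := M.X)
  rw [MonoidalCategory.whiskerLeft_comp, reassoc_of% (coev_dualLeftCoact (X := M.X) (Y := Y) M.coact)]
  calc _ = η_ M.X Y ≫ (M.coact ≫ M.X ◁ ε[A]) ▷ Y ≫ (α_ _ _ _).hom := by monoidal
    _ = _ := by rw [M.coact_counit]; monoidal

lemma dualLeftCoact_comul : dualLeftCoact (Y := Y) M.coact ≫ Δ[A] ▷ Y =
    dualLeftCoact M.coact ≫ A ◁ dualLeftCoact M.coact ≫ (α_ A A Y).inv := by
  apply mate_injective (X := M.X)
  rw [MonoidalCategory.whiskerLeft_comp, reassoc_of% (coev_dualLeftCoact (X := M.X) (Y := Y) M.coact),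
    MonoidalCategory.whiskerLeft_comp, reassoc_of% (coev_dualLeftCoact (X := M.X) (Y := Y) M.coact)]
  calc _ = η_ M.X Y ≫ (M.coact ≫ M.X ◁ Δ[A]) ▷ Y ≫ (α_ _ _ _).hom := by monoidal
    _ = 𝟙 _ ⊗≫ (η_ M.X Y ≫ M.coact ▷ Y ≫ (α_ M.X A Y).hom) ⊗≫ M.coact ▷ (A ⊗ Y) ⊗≫ 𝟙 _ := by
      rw [M.coact_comul]; monoidal
    _ = 𝟙 _ ⊗≫ η_ M.X Y ⊗≫ (M.X ◁ dualLeftCoact M.coact ≫ M.coact ▷ (A ⊗ Y)) ⊗≫ 𝟙 _ := by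
      rw [← coev_dualLeftCoact]; monoidal
    _ = _ := by
      rw [whisker_exchange]; monoidal

end

section Hopf
variable [SymmetricCategory C] {A : C} [HopfObj A]
open HopfObj

/-- A left coaction turned into a right coaction by means of the antipode. -/
def flipCoact {Y : C} (l : Y ⟶ A ⊗ Y) : Y ⟶ Y ⊗ A :=
  l ≫ (β_ A Y).hom ≫ Y ◁ 𝒮[A]

lemma flipCoact_counit {Y : C} (l : Y ⟶ A ⊗ Y) (h : l ≫ ε[A] ▷ Y = (λ_ Y).inv) :
    flipCoact l ≫ Y ◁ ε[A] = (ρ_ Y).inv := by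
  rw [flipCoact, Category.assoc, Category.assoc, ← MonoidalCategory.whiskerLeft_comp,
    antipode_counit, ← BraidedCategory.braiding_naturality_left, reassoc_of% h]
  simp

lemma flipCoact_comul {Y : C} (l : Y ⟶ A ⊗ Y)
    (h : l ≫ Δ[A] ▷ Y = l ≫ A ◁ l ≫ (α_ A A Y).inv) :
    flipCoact l ≫ Y ◁ Δ[A] = flipCoact l ≫ flipCoact l ▷ A ≫ (α_ Y A A).hom := by
  have hex : (α_ A A Y).inv ≫ (β_ (A ⊗ A) Y).hom ≫ Y ◁ (β_ A A).hom =
      (β_ A (A ⊗ Y)).hom ≫ (β_ A Y).hom ▷ A ≫ (α_ Y A A).hom := by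
    rw [← BraidedCategory.braiding_naturality_left, BraidedCategory.braiding_tensor_right_hom,
      BraidedCategory.braiding_tensor_left_hom]
    monoidal
  calc _ = (l ≫ Δ[A] ▷ Y) ≫ (β_ (A ⊗ A) Y).hom ≫ Y ◁ (β_ A A).hom ≫ Y ◁ (𝒮[A] ⊗ₘ 𝒮[A]) := by
        rw [flipCoact, Category.assoc, Category.assoc, ← MonoidalCategory.whiskerLeft_comp,
          antipode_comul, MonoidalCategory.whiskerLeft_comp,
          ← BraidedCategory.braiding_naturality_left_assoc]
        simp
    _ = l ≫ A ◁ l ≫ (β_ A (A ⊗ Y)).hom ≫ (β_ A Y).hom ▷ A ≫ (α_ Y A A).hom ≫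
          Y ◁ (𝒮[A] ⊗ₘ 𝒮[A]) := by
        rw [h]; simp only [Category.assoc]; rw [reassoc_of% hex]
    _ = l ≫ (β_ A Y).hom ≫ (l ▷ A ≫ (β_ A Y).hom ▷ A) ≫ (α_ Y A A).hom ≫
          Y ◁ (𝒮[A] ⊗ₘ 𝒮[A]) := by
        rw [BraidedCategory.braiding_naturality_right_assoc]; simp only [Category.assoc]
    _ = _ := by
        rw [MonoidalCategory.tensorHom_def']
        simp only [flipCoact, Category.assoc, comp_whiskerRight]
        rw [whisker_exchange_assoc, whisker_exchange_assoc]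
        monoidal

/-- The contragredient comodule structure on a dual `Y` of `M`. -/
def dual (M : Comod A) (Y : C) [ExactPairing M.X Y] : Comod A where
  X := Y
  coact := flipCoact (dualLeftCoact M.coact)
  coact_counit := flipCoact_counit _ (dualLeftCoact_counit M Y)
  coact_comul := flipCoact_comul _ (dualLeftCoact_comul M Y)

lemma dual_ev (M : Comod A) (Y : C) [ExactPairing M.X Y] :
    tensorCoact (M.dual Y).coact M.coact ≫ ε_ M.X Y ▷ A =
      ε_ M.X Y ≫ (λ_ (𝟙_ C)).inv ≫ 𝟙_ C ◁ η[A] := by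
  have hb : (β_ A Y).hom ▷ (M.X ⊗ A) ≫ tensorμ Y A M.X A ≫ ε_ M.X Y ▷ (A ⊗ A) =
      𝟙 _ ⊗≫ A ◁ ε_ M.X Y ▷ A ⊗≫ 𝟙 _ := by
    calc _ = 𝟙 _ ⊗≫ ((α_ A Y M.X).inv ≫ (β_ A Y).hom ▷ M.X ≫ (α_ Y A M.X).hom ≫
            Y ◁ (β_ A M.X).hom ≫ (α_ Y M.X A).inv) ▷ A ⊗≫ ε_ M.X Y ▷ A ▷ A ⊗≫ 𝟙 _ := by
          rw [tensorμ]; monoidal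
      _ = 𝟙 _ ⊗≫ ((β_ A (Y ⊗ M.X)).hom ≫ ε_ M.X Y ▷ A) ▷ A ⊗≫ 𝟙 _ := by
          rw [← BraidedCategory.braiding_tensor_right_hom]; monoidal
      _ = _ := by
          rw [← BraidedCategory.braiding_naturality_right, braiding_tensorUnit_right]; monoidal
  calc _ = (dualLeftCoact M.coact ⊗ₘ M.coact) ≫ (β_ A Y).hom ▷ (M.X ⊗ A) ≫
          (Y ◁ 𝒮[A]) ▷ (M.X ⊗ A) ≫ tensorμ Y A M.X A ≫ (Y ⊗ M.X) ◁ μ[A] ≫ ε_ M.X Y ▷ A := by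
        change tensorCoact (flipCoact (dualLeftCoact M.coact)) M.coact ≫ ε_ M.X Y ▷ A = _
        rw [tensorCoact, flipCoact, ← tensorHom_id (β_ A Y).hom, ← tensorHom_id (Y ◁ 𝒮[A])]
        simp only [Category.assoc, tensorHom_comp_tensorHom_assoc, Category.comp_id]
    _ = (dualLeftCoact M.coact ⊗ₘ M.coact) ≫ ((β_ A Y).hom ▷ (M.X ⊗ A) ≫
          tensorμ Y A M.X A ≫ ε_ M.X Y ▷ (A ⊗ A)) ≫ 𝟙_ C ◁ (𝒮[A] ▷ A ≫ μ[A]) := by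
        have h2 := tensorμ_natural (𝟙 Y) 𝒮[A] (𝟙 M.X) (𝟙 A)
        rw [id_tensorHom_id, tensorHom_id, id_tensorHom, id_tensorHom_id, id_tensorHom,
          tensorHom_id] at h2
        rw [reassoc_of% h2, ← MonoidalCategory.whiskerLeft_comp_assoc, whisker_exchange]
        simp only [Category.assoc]
    _ = 𝟙 _ ⊗≫ Y ◁ M.coact ⊗≫ (dualLeftCoact M.coact ▷ M.X ≫ (α_ A Y M.X).hom ≫
          A ◁ ε_ M.X Y ≫ (ρ_ A).hom) ▷ A ⊗≫ 𝟙_ C ◁ (𝒮[A] ▷ A ≫ μ[A]) := by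
        rw [hb, MonoidalCategory.tensorHom_def']; monoidal
    _ = 𝟙 _ ⊗≫ Y ◁ (M.coact ≫ M.coact ▷ A ≫ (α_ M.X A A).hom) ⊗≫
          (ε_ M.X Y ▷ (A ⊗ A) ≫ 𝟙_ C ◁ (𝒮[A] ▷ A ≫ μ[A])) := by
        rw [dualLeftCoact_ev]; monoidal
    _ = 𝟙 _ ⊗≫ Y ◁ M.coact ⊗≫ (Y ⊗ M.X) ◁ (Δ[A] ≫ 𝒮[A] ▷ A ≫ μ[A]) ≫ ε_ M.X Y ▷ A := by
        rw [← M.coact_comul, ← whisker_exchange]; monoidal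
    _ = 𝟙 _ ⊗≫ Y ◁ (M.coact ≫ M.X ◁ ε[A]) ⊗≫ ((Y ⊗ M.X) ◁ η[A] ≫ ε_ M.X Y ▷ A) := by
        rw [antipode_left]; monoidal
    _ = _ := by
        rw [M.coact_counit, whisker_exchange]; monoidal

lemma dual_coev (M : Comod A) (Y : C) [ExactPairing M.X Y] :
    ((λ_ (𝟙_ C)).inv ≫ 𝟙_ C ◁ η[A]) ≫ η_ M.X Y ▷ A =
      η_ M.X Y ≫ tensorCoact M.coact (M.dual Y).coact := by
  have hb : (M.X ⊗ A) ◁ (β_ A Y).hom ≫ tensorμ M.X A Y A =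
      𝟙 _ ⊗≫ M.X ◁ (β_ (A ⊗ A) Y).hom ⊗≫ 𝟙 _ := by
    rw [BraidedCategory.braiding_tensor_left_hom, tensorμ]; monoidal
  symm
  calc _ = η_ M.X Y ≫ (M.coact ⊗ₘ dualLeftCoact M.coact) ≫ ((M.X ⊗ A) ◁ (β_ A Y).hom ≫
          tensorμ M.X A Y A) ≫ (M.X ⊗ Y) ◁ (A ◁ 𝒮[A] ≫ μ[A]) := by
        have h2 := tensorμ_natural (𝟙 M.X) (𝟙 A) (𝟙 Y) 𝒮[A]
        rw [id_tensorHom_id, id_tensorHom_id, id_tensorHom, id_tensorHom, id_tensorHom,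
          id_tensorHom] at h2
        change η_ M.X Y ≫ tensorCoact M.coact (flipCoact (dualLeftCoact M.coact)) = _
        rw [MonoidalCategory.whiskerLeft_comp, Category.assoc, ← reassoc_of% h2, tensorCoact,
          flipCoact, ← id_tensorHom _ (β_ A Y).hom, ← id_tensorHom _ (Y ◁ 𝒮[A])]
        simp only [tensorHom_comp_tensorHom_assoc, Category.comp_id]
    _ = η_ M.X Y ≫ M.X ◁ dualLeftCoact M.coact ≫ M.coact ▷ (A ⊗ Y) ⊗≫
          M.X ◁ ((A ◁ 𝒮[A] ≫ μ[A]) ▷ Y ≫ (β_ A Y).hom) ⊗≫ 𝟙 _ := by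
        rw [BraidedCategory.braiding_naturality_left, hb, MonoidalCategory.tensorHom_def']; monoidal
    _ = η_ M.X Y ⊗≫ (M.coact ≫ M.coact ▷ A ≫ (α_ M.X A A).hom) ▷ Y ⊗≫
          M.X ◁ ((A ◁ 𝒮[A] ≫ μ[A]) ▷ Y ≫ (β_ A Y).hom) ⊗≫ 𝟙 _ := by
        rw [reassoc_of% (coev_dualLeftCoact (X := M.X) (Y := Y) M.coact)]; monoidal
    _ = η_ M.X Y ⊗≫ M.coact ▷ Y ⊗≫
          M.X ◁ ((Δ[A] ≫ A ◁ 𝒮[A] ≫ μ[A]) ▷ Y ≫ (β_ A Y).hom) ⊗≫ 𝟙 _ := by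
        rw [← M.coact_comul]; monoidal
    _ = η_ M.X Y ⊗≫ (M.coact ≫ M.X ◁ ε[A]) ▷ Y ⊗≫
          M.X ◁ (η[A] ▷ Y ≫ (β_ A Y).hom) ⊗≫ 𝟙 _ := by
        rw [antipode_right]; monoidal
    _ = 𝟙 _ ⊗≫ (η_ M.X Y ▷ 𝟙_ C ≫ (M.X ⊗ Y) ◁ η[A]) ⊗≫ 𝟙 _ := by
        rw [M.coact_counit, BraidedCategory.braiding_naturality_left, braiding_tensorUnit_left]
        monoidal
    _ = _ := by
        rw [← whisker_exchange]; monoidal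

/-- The contragredient comodule is a dual of `M`, with the evaluation and coevaluation of the
underlying objects. -/
abbrev exactPairing [IsCommMonObj A] (M : Comod A) (Y : C) [ExactPairing M.X Y] :
    ExactPairing M (M.dual Y) where
  coevaluation' := ⟨η_ M.X Y, dual_coev M Y⟩
  evaluation' := ⟨ε_ M.X Y, dual_ev M Y⟩
  coevaluation_evaluation' := hom_ext (ExactPairing.coevaluation_evaluation M.X Y)
  evaluation_coevaluation' := hom_ext (ExactPairing.evaluation_coevaluation M.X Y)

end Hopf
end Comod
end ComodDual

namespace SuperVect

section Dual
variable (X : SuperVect) [FiniteDimensional ℂ X.V]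

/-- The dual super vector space. -/
noncomputable def dual : SuperVect where
  V := ModuleCat.of ℂ (Module.Dual ℂ X.V)
  p := ModuleCat.ofHom X.p.hom.dualMap
  p_p := ModuleCat.hom_ext <| LinearMap.ext fun φ => LinearMap.ext fun x =>
    congrArg φ (X.p_p_apply x)

lemma coev_parity {V : Type} [AddCommGroup V] [Module ℂ V] [FiniteDimensional ℂ V]
    (p : V →ₗ[ℂ] V) (hp : ∀ v, p (p v) = v) :
    TensorProduct.map p p.dualMap ∘ₗ coevaluation ℂ V = coevaluation ℂ V := by
  apply LinearMap.ext_ring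
  rw [LinearMap.comp_apply]
  classical
  apply (TensorProduct.comm ℂ V (Module.Dual ℂ V)).injective
  apply (dualTensorHomEquivOfBasis (N := V) (Module.Basis.ofVectorSpace ℂ V)).injective
  ext v
  have h (w : V) : ∑ i, (Module.Basis.ofVectorSpace ℂ V).repr w i • Module.Basis.ofVectorSpace ℂ V i = w :=
    Module.Basis.sum_repr _ _
  simp only [coevaluation_apply_one, map_sum, TensorProduct.map_tmul, TensorProduct.comm_tmul,
    dualTensorHomEquivOfBasis_apply, LinearMap.sum_apply, dualTensorHom_apply, LinearMap.dualMap_apply,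
    Module.Basis.coord_apply, h]
  simp only [← map_smul]
  rw [← map_sum, h, hp]

/-- Evaluation and coevaluation for a finite-dimensional super vector space. -/
noncomputable instance exactPairing : ExactPairing X X.dual where
  coevaluation' := ⟨ModuleCat.ofHom (coevaluation ℂ X.V), ModuleCat.hom_ext
    (coev_parity X.p.hom X.p_p_apply).symm⟩
  evaluation' := ⟨ModuleCat.ofHom (contractLeft ℂ X.V), ModuleCat.hom_ext
    (TensorProduct.ext' fun (φ : Module.Dual ℂ X.V) x => by
      change φ (X.p.hom (X.p.hom x)) = φ x
      rw [p_p_apply])⟩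
  coevaluation_evaluation' := hom_ext (ModuleCat.hom_ext (contractLeft_assoc_coevaluation ℂ X.V))
  evaluation_coevaluation' := hom_ext (ModuleCat.hom_ext (contractLeft_assoc_coevaluation' ℂ X.V))

end Dual

end SuperVect

section Rep
variable (A : SuperVect) [HopfObj A]

/-- The comodules whose underlying super vector space is finite-dimensional. -/
def finiteDim : ObjectProperty (Comod A) := fun M => FiniteDimensional ℂ M.X.V

instance : (finiteDim A).IsMonoidal where
  prop_unit := Module.Finite.self ℂ
  prop_tensor M N (_ : Module.Finite _ _) (_ : Module.Finite _ _) :=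
    Module.Finite.tensorProduct ℂ M.X.V N.X.V

/-- The category of finite-dimensional (super) comodules over a Hopf superalgebra `A`, with the parity
preserving comodule maps as morphisms. -/
abbrev FinRep := (finiteDim A).FullSubcategory

variable [IsCommMonObj A]
/-- Every finite-dimensional comodule has a dual, the contragredient one. -/
noncomputable instance : RightRigidCategory (FinRep A) where
  rightDual M :=
    let : FiniteDimensional ℂ M.obj.X.V := M.property
    { rightDual := ⟨M.obj.dual M.obj.X.dual, Subspace.instModuleDualFiniteDimensional⟩
      exact :=
        let := Comod.exactPairing M.obj M.obj.X.dual
        { coevaluation' := ObjectProperty.homMk (η_ M.obj (M.obj.dual M.obj.X.dual))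
          evaluation' := ObjectProperty.homMk (ε_ M.obj (M.obj.dual M.obj.X.dual))
          coevaluation_evaluation' := ObjectProperty.hom_ext _
            (ExactPairing.coevaluation_evaluation M.obj (M.obj.dual M.obj.X.dual))
          evaluation_coevaluation' := ObjectProperty.hom_ext _
            (ExactPairing.evaluation_coevaluation M.obj (M.obj.dual M.obj.X.dual)) } }

end Rep

namespace SuperVect

section Ker
variable {X Y : SuperVect} (φ : X ⟶ Y)

/-- The kernel of a morphism of super vector spaces. -/
noncomputable def ker : SuperVect where
  V := ModuleCat.of ℂ (LinearMap.ker φ.hom.hom)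
  p := ModuleCat.ofHom (X.p.hom.restrict (p := LinearMap.ker φ.hom.hom)
    (q := LinearMap.ker φ.hom.hom) fun x hx => by
      have h : φ.hom.hom (X.p.hom x) = Y.p.hom (φ.hom.hom x) :=
        LinearMap.congr_fun (congrArg ModuleCat.Hom.hom φ.comm) x
      rw [LinearMap.mem_ker] at hx ⊢
      rw [h, hx, map_zero])
  p_p := ModuleCat.hom_ext <| LinearMap.ext fun x => Subtype.ext (X.p_p_apply x.1)

/-- The inclusion of the kernel. -/
noncomputable def kerι : ker φ ⟶ X where
  hom := ModuleCat.ofHom (LinearMap.ker φ.hom.hom).subtype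
  comm := rfl

lemma kerι_comp : kerι φ ≫ φ = 0 :=
  hom_ext <| ModuleCat.hom_ext <| LinearMap.ext fun x => x.2

lemma mono_of_injective {X Y : SuperVect} (f : X ⟶ Y) (h : Function.Injective f.hom.hom) :
    Mono f where
  right_cancellation _ _ hgk := hom_ext <| ModuleCat.hom_ext <| LinearMap.ext fun x =>
    h (LinearMap.congr_fun (congrArg (fun q => ModuleCat.Hom.hom (Hom.hom q)) hgk) x)

lemma injective_whiskerRight (f : X ⟶ Y) (h : Function.Injective f.hom.hom) (Z : SuperVect) :
    Function.Injective (f ▷ Z).hom.hom :=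
  Module.Flat.rTensor_preserves_injective_linearMap (M := Z.V) f.hom.hom h

lemma kerι_injective : Function.Injective (kerι φ).hom.hom := Subtype.val_injective

instance (Z : SuperVect) : Mono (kerι φ ▷ Z) :=
  mono_of_injective _ (injective_whiskerRight _ (kerι_injective φ) Z)

instance : Mono (kerι φ) := mono_of_injective _ (kerι_injective φ)

lemma exists_lift_of_injective {I W U : SuperVect} (j : I ⟶ W) (hj : Function.Injective j.hom.hom)
    (g : U ⟶ W) (h : ∀ u, g.hom.hom u ∈ LinearMap.range j.hom.hom) :
    ∃ g' : U ⟶ I, g' ≫ j = g := by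
  let e := LinearEquiv.ofInjective j.hom.hom hj
  let k : U.V →ₗ[ℂ] I.V := e.symm.toLinearMap ∘ₗ g.hom.hom.codRestrict _ h
  have hk (u) : j.hom.hom (k u) = g.hom.hom u :=
    congrArg Subtype.val (e.apply_symm_apply (g.hom.hom.codRestrict _ h u))
  have hjc (u) : j.hom.hom (I.p.hom u) = W.p.hom (j.hom.hom u) :=
    LinearMap.congr_fun (congrArg ModuleCat.Hom.hom j.comm) u
  have hgc (u) : g.hom.hom (U.p.hom u) = W.p.hom (g.hom.hom u) :=
    LinearMap.congr_fun (congrArg ModuleCat.Hom.hom g.comm) u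
  refine ⟨⟨ModuleCat.ofHom k, ModuleCat.hom_ext (LinearMap.ext fun u => hj ?_)⟩,
    hom_ext (ModuleCat.hom_ext (LinearMap.ext hk))⟩
  change j.hom.hom (k (U.p.hom u)) = j.hom.hom (I.p.hom (k u))
  rw [hk, hjc, hk, hgc]

lemma exists_lift_whiskerRight {U Z : SuperVect} (g : U ⟶ X ⊗ Z) (h : g ≫ φ ▷ Z = 0) :
    ∃ g' : U ⟶ ker φ ⊗ Z, g' ≫ kerι φ ▷ Z = g := by
  refine exists_lift_of_injective _ (injective_whiskerRight _ (kerι_injective φ) Z) g fun u => ?_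
  have hex := Module.Flat.rTensor_exact (M := Z.V)
    (f := (LinearMap.ker φ.hom.hom).subtype) (g := φ.hom.hom)
    (LinearMap.exact_subtype_ker_map _)
  have hu : (φ ▷ Z).hom.hom (g.hom.hom u) = 0 :=
    LinearMap.congr_fun (congrArg (fun q => ModuleCat.Hom.hom (Hom.hom q)) h) u
  exact (hex _).1 hu

lemma exists_lift {U : SuperVect} (g : U ⟶ X) (h : g ≫ φ = 0) :
    ∃ g' : U ⟶ ker φ, g' ≫ kerι φ = g := by
  refine exists_lift_of_injective _ (kerι_injective φ) g fun u => ?_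
  have hu : φ.hom.hom (g.hom.hom u) = 0 :=
    LinearMap.congr_fun (congrArg (fun q => ModuleCat.Hom.hom (Hom.hom q)) h) u
  exact ⟨⟨_, hu⟩, rfl⟩

end Ker
end SuperVect

namespace Comod
section Sub
universe v u
variable {C : Type u} [Category.{v} C] [MonoidalCategory C] {A : C} [ComonObj A]

/-- The subcomodule of `N` on a subobject `i : I ⟶ N` whose coaction `ρ` is the restriction of the
coaction of `N`. -/
def sub (N : Comod A) {I : C} (i : I ⟶ N.X) [Mono i] [Mono (i ▷ (A ⊗ A))] (ρ : I ⟶ I ⊗ A)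
    (h : ρ ≫ i ▷ A = i ≫ N.coact) : Comod A where
  X := I
  coact := ρ
  coact_counit := by
    have hm : Mono (i ▷ 𝟙_ C) := by
      have e : i ▷ 𝟙_ C = (ρ_ I).hom ≫ i ≫ (ρ_ N.X).inv := by simp
      rw [e]
      infer_instance
    rw [← cancel_mono (i ▷ 𝟙_ C), Category.assoc, whisker_exchange, reassoc_of% h, N.coact_counit,
      rightUnitor_inv_naturality]
  coact_comul := by
    rw [← cancel_mono (i ▷ (A ⊗ A))]
    simp only [Category.assoc]
    rw [whisker_exchange, reassoc_of% h, N.coact_comul, ← associator_naturality_left,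
      ← comp_whiskerRight_assoc, h, comp_whiskerRight_assoc, reassoc_of% h]

variable (A) in
/-- The regular comodule: `A` with its comultiplication as the coaction. -/
abbrev regular : Comod A where
  X := A
  coact := Δ[A]
  coact_counit := ComonObj.comul_counit A
  coact_comul := ComonObj.comul_assoc A

end Sub

section Res
universe v u
variable {C : Type u} [Category.{v} C] [MonoidalCategory C]

/-- The functor that composes coactions with a morphism of comonoids `r : A ⟶ B`. -/
@[simps]
def res {A B : C} [ComonObj A] [ComonObj B] (r : A ⟶ B) [IsComonHom r] : Comod A ⥤ Comod B where
  obj M :=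
    { X := M.X
      coact := M.coact ≫ M.X ◁ r
      coact_counit := by
        rw [Category.assoc, ← MonoidalCategory.whiskerLeft_comp, IsComonHom.hom_counit,
          M.coact_counit]
      coact_comul := by
        rw [Category.assoc, ← MonoidalCategory.whiskerLeft_comp, IsComonHom.hom_comul,
          MonoidalCategory.whiskerLeft_comp, reassoc_of% M.coact_comul]
        simp only [comp_whiskerRight, Category.assoc, MonoidalCategory.tensorHom_def']
        rw [whisker_exchange_assoc]
        monoidal }
  map {M N} f := ⟨f.hom, by
    change (M.coact ≫ M.X ◁ r) ≫ f.hom ▷ B = f.hom ≫ N.coact ≫ N.X ◁ r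
    rw [Category.assoc, whisker_exchange, reassoc_of% (Hom.comm f)]⟩

instance {A B : C} [ComonObj A] [ComonObj B] (r : A ⟶ B) [IsComonHom r] [Preadditive C]
    [MonoidalPreadditive C] : (res r).Additive where
  map_add := rfl

instance {A B : C} [ComonObj A] [ComonObj B] (r : A ⟶ B) [IsComonHom r] [Preadditive C]
    [MonoidalPreadditive C] {k : Type*} [CommRing k] [Linear k C] [MonoidalLinear k C] :
    (res r).Linear k where
  map_smul _ _ := rfl

variable [BraidedCategory C] {A B : C} [BimonObj A] [BimonObj B] (r : A ⟶ B) [IsBimonHom r]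

lemma tensorCoact_res {X Y : C} (a : X ⟶ X ⊗ A) (b : Y ⟶ Y ⊗ A) :
    tensorCoact (a ≫ X ◁ r) (b ≫ Y ◁ r) = tensorCoact a b ≫ (X ⊗ Y) ◁ r := by
  have h := tensorμ_natural (𝟙 X) r (𝟙 Y) r
  rw [id_tensorHom, id_tensorHom, id_tensorHom_id, id_tensorHom] at h
  rw [tensorCoact, ← tensorHom_comp_tensorHom, Category.assoc, reassoc_of% h,
    ← MonoidalCategory.whiskerLeft_comp, ← IsMonHom.mul_hom, tensorCoact]
  simp only [Category.assoc, MonoidalCategory.whiskerLeft_comp]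

lemma unitCoact_res : (λ_ (𝟙_ C)).inv ≫ 𝟙_ C ◁ η[B] =
    ((λ_ (𝟙_ C)).inv ≫ 𝟙_ C ◁ η[A]) ≫ 𝟙_ C ◁ r := by
  rw [Category.assoc, ← MonoidalCategory.whiskerLeft_comp, IsMonHom.one_hom]

lemma res_aux {X D : C} {a b : X ⟶ X ⊗ D} (h : a = b) :
    a ≫ (Iso.refl X).hom ▷ D = (Iso.refl X).hom ≫ b := by
  rw [h, Iso.refl_hom, MonoidalCategory.id_whiskerRight, Category.comp_id, Category.id_comp]

def resUnit : 𝟙_ (Comod B) ≅ (res r).obj (𝟙_ (Comod A)) :=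
  mkIso (Iso.refl (𝟙_ C)) (res_aux (unitCoact_res r))

def resTensor (M N : Comod A) : (res r).obj M ⊗ (res r).obj N ≅ (res r).obj (M ⊗ N) :=
  mkIso (Iso.refl (M.X ⊗ N.X)) (res_aux (tensorCoact_res r M.coact N.coact))

@[simp] lemma resUnit_hom_hom : (resUnit r).hom.hom = 𝟙 (𝟙_ C) := rfl
@[simp] lemma resTensor_hom_hom (M N : Comod A) : (resTensor r M N).hom.hom = 𝟙 (M.X ⊗ N.X) := rfl

end Res
end Comod

section RepRes
variable {A B : SuperVect} [HopfObj A] [HopfObj B] (r : A ⟶ B) [IsBimonHom r]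

/-- Restriction of finite-dimensional comodules along a morphism `r : A ⟶ B` of Hopf superalgebras. -/
@[simps]
def FinRep.res : FinRep A ⥤ FinRep B where
  obj M := ⟨(Comod.res r).obj M.obj, M.property⟩
  map f := ObjectProperty.homMk ((Comod.res r).map f.hom)

instance : (FinRep.res r).Additive where
  map_add := rfl

instance : (FinRep.res r).Linear ℂ where
  map_smul _ _ := rfl

lemma FinRep.hom_ext {M N : FinRep A} {f g : M ⟶ N} (h : f.hom.hom = g.hom.hom) : f = g :=
  ObjectProperty.hom_ext _ (Comod.hom_ext h)

noncomputable instance : (FinRep.res r).Monoidal :=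
  Functor.CoreMonoidal.toMonoidal
    { εIso := ObjectProperty.isoMk _ (Comod.resUnit r)
      μIso := fun M N => ObjectProperty.isoMk _ (Comod.resTensor r M.obj N.obj)
      μIso_hom_natural_left := fun f N => FinRep.hom_ext <|
        (Category.comp_id (f.hom.hom ▷ N.obj.X)).trans (Category.id_comp _).symm
      μIso_hom_natural_right := fun M f => FinRep.hom_ext <|
        (Category.comp_id (M.obj.X ◁ f.hom.hom)).trans (Category.id_comp _).symm
      associativity := fun M N P => FinRep.hom_ext <| by
        change 𝟙 (M.obj.X ⊗ N.obj.X) ▷ P.obj.X ≫ 𝟙 _ ≫ (α_ M.obj.X N.obj.X P.obj.X).hom =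
          (α_ M.obj.X N.obj.X P.obj.X).hom ≫ M.obj.X ◁ 𝟙 (N.obj.X ⊗ P.obj.X) ≫ 𝟙 _
        simp
      left_unitality := fun M => FinRep.hom_ext <| by
        change (λ_ M.obj.X).hom = 𝟙 (𝟙_ _) ▷ M.obj.X ≫ 𝟙 _ ≫ (λ_ M.obj.X).hom
        simp
      right_unitality := fun M => FinRep.hom_ext <| by
        change (ρ_ M.obj.X).hom = M.obj.X ◁ 𝟙 (𝟙_ _) ≫ 𝟙 _ ≫ (ρ_ M.obj.X).hom
        simp }

noncomputable instance [IsCommMonObj A] [IsCommMonObj B] : (FinRep.res r).Braided where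
  braided M N := FinRep.hom_ext <| (Category.id_comp (β_ M.obj.X N.obj.X).hom).trans (Category.comp_id _).symm

end RepRes

/-- An affine algebraic supergroup `G` over `ℂ`, given by its coordinate superalgebra `A = ℂ[G]`: a
supercommutative Hopf superalgebra over `ℂ` (a commutative Hopf monoid in super vector spaces) that
is finitely generated as an algebra. -/
structure AlgSupergroup where
  A : SuperVect
  [hopf : HopfObj A]
  [comm : IsCommMonObj A]
  finite_type : ∃ s : Finset A.V, ∀ W : Submodule ℂ A.V, A.one ∈ W → (∀ a ∈ s, a ∈ W) →
    (∀ a ∈ W, ∀ b ∈ W, A.mul a b ∈ W) → W = ⊤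

namespace AlgSupergroup

attribute [instance] hopf comm

/-- The category `Rep G` of finite-dimensional representations of `G`, i.e. of finite-dimensional
`ℂ[G]`-supercomodules and parity preserving comodule maps. -/
abbrev Rep (G : AlgSupergroup) := FinRep G.A

/-- A closed sub-supergroup `K` of `G`: a surjective morphism `r : ℂ[G] ⟶ ℂ[K]` of Hopf
superalgebras, the restriction of functions. -/
structure ClosedSubgroup (G : AlgSupergroup) where
  group : AlgSupergroup
  r : G.A ⟶ group.A
  [isBimonHom : IsBimonHom r]
  surjective : Function.Surjective r.hom.hom

attribute [instance] ClosedSubgroup.isBimonHom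

variable {G : AlgSupergroup}

/-- The restriction functor `Rep G ⥤ Rep K`. -/
noncomputable abbrev Res (K : G.ClosedSubgroup) : G.Rep ⥤ K.group.Rep := FinRep.res K.r

/-- The map `ℂ[G] ⟶ ℂ[K] ⊗ ℂ[G]`, `a ↦ r(a₁) ⊗ a₂ - 1 ⊗ a`, whose kernel consists of the functions
`a` on `G` that are left `K`-invariant, `a(kg) = a(g)`. -/
noncomputable def invDefect (K : G.ClosedSubgroup) : G.A ⟶ K.group.A ⊗ G.A :=
  Δ[G.A] ≫ K.r ▷ G.A - (λ_ G.A).inv ≫ η[K.group.A] ▷ G.A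

lemma exists_indCoact (K : G.ClosedSubgroup) :
    ∃ ρ : SuperVect.ker (invDefect K) ⟶ SuperVect.ker (invDefect K) ⊗ G.A,
      ρ ≫ SuperVect.kerι (invDefect K) ▷ G.A = SuperVect.kerι (invDefect K) ≫ Δ[G.A] := by
  apply SuperVect.exists_lift_whiskerRight
  have h : Δ[G.A] ≫ invDefect K ▷ G.A = invDefect K ≫ K.group.A ◁ Δ[G.A] ≫ (α_ _ _ _).inv := by
    have e : invDefect K ▷ G.A = (Δ[G.A] ≫ K.r ▷ G.A) ▷ G.A -
        ((λ_ G.A).inv ≫ η[K.group.A] ▷ G.A) ▷ G.A := (tensorRight G.A).map_sub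
    rw [e, invDefect, Preadditive.comp_sub, Preadditive.sub_comp]
    congr 1
    rw [comp_whiskerRight, Category.assoc, ← whisker_exchange_assoc, ComonObj.comul_assoc_assoc]
    monoidal
  rw [Category.assoc, h, ← Category.assoc, SuperVect.kerι_comp, Limits.zero_comp]

/-- Right translation on the left `K`-invariant functions, the restriction of the comultiplication. -/
noncomputable def indCoact (K : G.ClosedSubgroup) := (exists_indCoact K).choose

/-- The `G`-module `Ind_K^G ℂ` that is induced from the trivial module: the functions on `G` that are
left `K`-invariant, with `G` acting by right translation. -/
noncomputable def indTrivial (K : G.ClosedSubgroup) : Comod G.A :=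
  Comod.sub (Comod.regular G.A) (SuperVect.kerι (invDefect K)) (indCoact K)
    (exists_indCoact K).choose_spec

lemma exists_indUnit (K : G.ClosedSubgroup) :
    ∃ u : 𝟙_ SuperVect ⟶ SuperVect.ker (invDefect K),
      u ≫ SuperVect.kerι (invDefect K) = η[G.A] := by
  apply SuperVect.exists_lift
  rw [invDefect, Preadditive.comp_sub, sub_eq_zero, Bimon.one_comul_assoc,
    leftUnitor_inv_naturality_assoc, MonoidalCategory.tensorHom_def']
  simp only [Category.assoc]
  rw [← comp_whiskerRight, IsMonHom.one_hom]

/-- The natural `G`-map `ℂ ⟶ Ind_K^G ℂ`, the unit of the adjunction between restriction and induction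
at the trivial module: it sends `1` to the constant function `1`. -/
noncomputable def indUnit (K : G.ClosedSubgroup) : 𝟙_ (Comod G.A) ⟶ indTrivial K where
  hom := (exists_indUnit K).choose
  comm := by
    have hu := (exists_indUnit K).choose_spec
    have hρ : indCoact K ≫ _ = _ := (exists_indCoact K).choose_spec
    change ((λ_ (𝟙_ SuperVect)).inv ≫ 𝟙_ SuperVect ◁ η[G.A]) ≫ (exists_indUnit K).choose ▷ G.A =
      (exists_indUnit K).choose ≫ indCoact K
    rw [← cancel_mono (SuperVect.kerι (invDefect K) ▷ G.A), Category.assoc, Category.assoc,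
      ← comp_whiskerRight, hu]
    rw [Category.assoc, hρ, reassoc_of% hu, Bimon.one_comul, MonoidalCategory.tensorHom_def']

/-- `K` is splitting in `G` if the natural `G`-map `ℂ ⟶ Ind_K^G ℂ` has a left inverse
`Ind_K^G ℂ ⟶ ℂ` that is a `G`-map. -/
def IsSplitting (K : G.ClosedSubgroup) : Prop := IsSplitMono (indUnit K)

/-- `H` is the underlying even group `G₀` of `G`: its coordinate superalgebra is purely even and is
the quotient of `ℂ[G]` by the ideal generated by the odd functions (every two-sided ideal `I` that
contains the odd functions contains the kernel of `r`). -/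
structure ClosedSubgroup.IsEvenPart (H : G.ClosedSubgroup) : Prop where
  even : H.group.A.p = 𝟙 _
  ker_le : ∀ I : Submodule ℂ G.A.V, (∀ a, G.A.p.hom a = -a → a ∈ I) →
    (∀ a, ∀ b ∈ I, G.A.mul a b ∈ I ∧ G.A.mul b a ∈ I) → ∀ a, H.r.hom.hom a = 0 → a ∈ I

/-- Every finite-dimensional representation is completely reducible: each subrepresentation has a
complement. -/
def IsLinearlyReductive (H : AlgSupergroup) : Prop :=
  ∀ ⦃M N : H.Rep⦄ (i : M ⟶ N), Mono i → IsSplitMono i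

/-- `G` is quasireductive if its underlying even group `G₀` is linearly reductive. Since we are in
characteristic zero, this says that the identity component of `G₀` is reductive; `G` need not be
connected. -/
def IsQuasireductive (G : AlgSupergroup) : Prop :=
  ∃ H : G.ClosedSubgroup, H.IsEvenPart ∧ H.group.IsLinearlyReductive

end AlgSupergroup

/-!
Let `A = ℂ[G]`. The proof has three independent parts.

*Restriction preserves negligible morphisms* (`AlgSupergroup.negligible_res_map`). The trace of `h ≫ f`
for a `G`-map `f : M ⟶ N` and a `K`-map `h : N ⟶ M` is the value of a `K`-invariant functional on
`N ⊗ Mᘁ`, given by `h`, at a `G`-invariant vector, given by `f`. A `K`-invariant functional `u` on a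
`G`-module `W` is by Frobenius reciprocity a `G`-map `W ⟶ Ind_K^G ℂ`; composing it with a splitting
`Ind_K^G ℂ ⟶ ℂ` gives a `G`-invariant functional that agrees with `u` on the `G`-invariant vectors,
since these are mapped to constant functions (`AlgSupergroup.exists_invariant_functional`). So
`tr (h ≫ f) = tr (g ≫ f)` for some `G`-map `g`, and this is zero if `f` is negligible.

*The induced functor* (`Semisimplification.induced`) is defined on representatives and inherits its
structure from restriction. It is faithful because restriction is faithful and preserves traces: all
pairings of `f` in `Rep G` occur among the pairings of its restriction (`Negligible.of_map`).

*Exactness.* Every morphism `f` of the semisimplification of `Rep G` has a pseudo-inverse `g`,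
`f ≫ g ≫ f = f` (`Semisimplification.isVonNeumannRegular`). Indeed, nilpotent endomorphisms in `Rep G`
have trace zero since the trace is the supertrace, hence the finite-dimensional algebras `End X` of the
semisimplification have zero Jacobson radical and are semisimple, and an idempotent generator of the
left ideal `{f ≫ g}` of `End X` supplies the pseudo-inverse. In a preadditive category with
pseudo-inverses all kernels are split, so every additive functor preserves the finite limits and
colimits that exist (`IsVonNeumannRegular.preservesFiniteLimits`).
-/

/-! ### Traces and negligible morphisms under a symmetric monoidal functor -/

section BraidedFunctor
universe v₁ v₂ u₁ u₂
variable {C : Type u₁} [Category.{v₁} C] [MonoidalCategory C] [SymmetricCategory C]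
  {D : Type u₂} [Category.{v₂} D] [MonoidalCategory D] [SymmetricCategory D]
  (R : C ⥤ D) [R.Braided]

/-- A monoidal functor carries an exact pairing to an exact pairing. -/
abbrev mapExactPairing (X Y : C) [ExactPairing X Y] : ExactPairing (R.obj X) (R.obj Y) where
  coevaluation' := Functor.LaxMonoidal.ε R ≫ R.map (η_ X Y) ≫ Functor.OplaxMonoidal.δ R X Y
  evaluation' := Functor.LaxMonoidal.μ R Y X ≫ R.map (ε_ X Y) ≫ Functor.OplaxMonoidal.η R
  coevaluation_evaluation' := by
    have h := congrArg R.map (ExactPairing.coevaluation_evaluation X Y)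
    simp only [Functor.map_comp, Functor.Monoidal.map_whiskerLeft, Functor.Monoidal.map_whiskerRight,
      Functor.Monoidal.map_associator_inv, Functor.Monoidal.map_rightUnitor,
      Functor.Monoidal.map_leftUnitor_inv, Category.assoc, Functor.Monoidal.μ_δ_assoc] at h
    replace h := ((R.obj Y ◁ Functor.LaxMonoidal.ε R ≫ Functor.LaxMonoidal.μ R Y (𝟙_ C)) ≫= h) =≫
      (Functor.OplaxMonoidal.δ R (𝟙_ C) Y ≫ Functor.OplaxMonoidal.η R ▷ R.obj Y)
    simpa only [Category.assoc, Functor.Monoidal.μ_δ, Functor.Monoidal.μ_δ_assoc, Category.comp_id,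
      Functor.Monoidal.whiskerLeft_ε_η, Functor.Monoidal.whiskerLeft_ε_η_assoc,
      Functor.Monoidal.whiskerRight_ε_η, Functor.Monoidal.whiskerRight_ε_η_assoc,
      MonoidalCategory.whiskerLeft_comp, MonoidalCategory.comp_whiskerRight] using h
  evaluation_coevaluation' := by
    have h := congrArg R.map (ExactPairing.evaluation_coevaluation X Y)
    simp only [Functor.map_comp, Functor.Monoidal.map_whiskerLeft, Functor.Monoidal.map_whiskerRight,
      Functor.Monoidal.map_associator, Functor.Monoidal.map_leftUnitor,
      Functor.Monoidal.map_rightUnitor_inv, Category.assoc, Functor.Monoidal.μ_δ_assoc] at h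
    replace h := ((Functor.LaxMonoidal.ε R ▷ R.obj X ≫ Functor.LaxMonoidal.μ R (𝟙_ C) X) ≫= h) =≫
      (Functor.OplaxMonoidal.δ R X (𝟙_ C) ≫ R.obj X ◁ Functor.OplaxMonoidal.η R)
    simpa only [Category.assoc, Functor.Monoidal.μ_δ, Functor.Monoidal.μ_δ_assoc, Category.comp_id,
      Functor.Monoidal.whiskerLeft_ε_η, Functor.Monoidal.whiskerLeft_ε_η_assoc,
      Functor.Monoidal.whiskerRight_ε_η, Functor.Monoidal.whiskerRight_ε_η_assoc,
      MonoidalCategory.whiskerLeft_comp, MonoidalCategory.comp_whiskerRight] using h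

lemma catTrace_map [RightRigidCategory C] [RightRigidCategory D] {X : C} (f : X ⟶ X) :
    catTrace (R.map f) =
      Functor.LaxMonoidal.ε R ≫ R.map (catTrace f) ≫ Functor.OplaxMonoidal.η R := by
  let := mapExactPairing R X Xᘁ
  rw [catTrace_eq (R.obj Xᘁ), traceWith]
  change (Functor.LaxMonoidal.ε R ≫ R.map (η_ X Xᘁ) ≫ Functor.OplaxMonoidal.δ R X Xᘁ) ≫
    R.map f ▷ R.obj Xᘁ ≫ (β_ (R.obj X) (R.obj Xᘁ)).hom ≫
      Functor.LaxMonoidal.μ R Xᘁ X ≫ R.map (ε_ X Xᘁ) ≫ Functor.OplaxMonoidal.η R = _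
  rw [← Functor.LaxBraided.braided_assoc]
  simp [catTrace]

/-- Every functional on `N ⊗ Y`, where `Y` is dual to `X`, comes from a morphism `N ⟶ X`. -/
lemma exists_whiskerRight_braiding_evaluation {X Y N : C} [ExactPairing X Y] (u : N ⊗ Y ⟶ 𝟙_ C) :
    ∃ g : N ⟶ X, g ▷ Y ≫ (β_ X Y).hom ≫ ε_ X Y = u := by
  refine ⟨tensorLeftHomEquiv N X Y (𝟙_ C) ((β_ Y N).hom ≫ u) ≫ (ρ_ X).hom, ?_⟩
  set k := tensorLeftHomEquiv N X Y (𝟙_ C) ((β_ Y N).hom ≫ u) with hk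
  have h : (tensorLeftHomEquiv N X Y (𝟙_ C)).symm k = (β_ Y N).hom ≫ u := by
    rw [hk, Equiv.symm_apply_apply]
  have h2 : (tensorLeftHomEquiv N X Y (𝟙_ C)).symm k = Y ◁ (k ≫ (ρ_ X).hom) ≫ ε_ X Y := by
    change Y ◁ k ≫ (α_ _ _ _).inv ≫ ε_ X Y ▷ _ ≫ (λ_ _).hom = _
    rw [unitors_equal, rightUnitor_naturality]
    monoidal
  rw [BraidedCategory.braiding_naturality_left_assoc, ← h2, h,
    SymmetricCategory.symmetry_assoc]

variable [RightRigidCategory C] [RightRigidCategory D] [Preadditive C] [Preadditive D]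
  [MonoidalPreadditive C] [MonoidalPreadditive D]

/-- If every functional on `R.obj W` can be replaced by the image of a functional on `W` without
changing its values on the invariants `𝟙 ⟶ W`, then `R` preserves negligible morphisms: a morphism
`h : R.obj Y ⟶ R.obj X` pairs with `f : X ⟶ Y` through the value of the functional
`Y ⊗ Xᘁ ⟶ 𝟙` given by `h` at the invariant given by `f`. -/
lemma Negligible.map_of_functionals [R.Additive]
    (hR : ∀ (W : C) (u : R.obj W ⟶ 𝟙_ D), ∃ u' : W ⟶ 𝟙_ C, ∀ w : 𝟙_ C ⟶ W,
      R.map w ≫ u = R.map (w ≫ u') ≫ Functor.OplaxMonoidal.η R)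
    {X Y : C} {f : X ⟶ Y} (hf : Negligible f) : Negligible (R.map f) := by
  intro h
  let := mapExactPairing R X Xᘁ
  obtain ⟨u', hu'⟩ := hR (Y ⊗ Xᘁ) (Functor.OplaxMonoidal.δ R Y Xᘁ ≫ h ▷ R.obj Xᘁ ≫
    (β_ (R.obj X) (R.obj Xᘁ)).hom ≫ ε_ (R.obj X) (R.obj Xᘁ))
  obtain ⟨g, hg⟩ := exists_whiskerRight_braiding_evaluation (X := X) (Y := Xᘁ) u'
  have key : (η_ X Xᘁ ≫ f ▷ Xᘁ) ≫ u' = 0 := by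
    rw [← hg, ← hf g, catTrace_comm, catTrace]
    simp
  have h0 := hu' (η_ X Xᘁ ≫ f ▷ Xᘁ)
  rw [key, Functor.map_zero, Limits.zero_comp] at h0
  rw [catTrace_comm, catTrace_eq (R.obj Xᘁ), traceWith,
    ← Limits.comp_zero (f := Functor.LaxMonoidal.ε R), ← h0]
  change (Functor.LaxMonoidal.ε R ≫ R.map (η_ X Xᘁ) ≫ Functor.OplaxMonoidal.δ R X Xᘁ) ≫ _ = _
  simp only [Category.assoc, Functor.map_comp, comp_whiskerRight,
    Functor.OplaxMonoidal.δ_natural_left_assoc]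

/-- The pairings of `f` with morphisms of `C` are among the pairings of `R.map f`. -/
lemma Negligible.of_map [R.Faithful] [R.Additive] {X Y : C} {f : X ⟶ Y} (hf : Negligible (R.map f)) :
    Negligible f := fun g => by
  have h := hf (R.map g)
  rw [← Functor.map_comp, catTrace_map] at h
  apply R.map_injective
  rw [← cancel_epi (Functor.LaxMonoidal.ε R), ← cancel_mono (Functor.OplaxMonoidal.η R),
    Category.assoc, h]
  simp

variable (hN : ∀ ⦃X Y : C⦄ (f : X ⟶ Y), Negligible f → Negligible (R.map f))

/-- The functor between semisimplifications that is induced by a functor preserving negligible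
morphisms. -/
def Semisimplification.induced [R.Additive]
    (hN : ∀ ⦃X Y : C⦄ (f : X ⟶ Y), Negligible f → Negligible (R.map f)) :
    Semisimplification C ⥤ Semisimplification D :=
  CategoryTheory.Quotient.lift _ (R ⋙ Semisimplification.functor D) fun X Y f g h =>
    (CategoryTheory.Quotient.functor_map_eq_iff _ _ _).2 <| by
      have := hN _ h
      rwa [R.map_sub] at this

namespace Semisimplification
variable [R.Additive]

lemma functor_comp_induced : functor C ⋙ induced R hN = R ⋙ functor D := rfl

lemma functor_map_eq_zero_iff {X Y : C} (f : X ⟶ Y) : (functor C).map f = 0 ↔ Negligible f := by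
  rw [← (functor C).map_zero, Quotient.functor_map_eq_iff]
  change Negligible (f - 0) ↔ _
  rw [sub_zero]

instance : (induced R hN).Additive where
  map_add {X Y f g} := by
    obtain ⟨f, rfl⟩ := exists_map f
    obtain ⟨g, rfl⟩ := exists_map g
    exact congrArg (functor D).map (R.map_add (f := f) (g := g))

instance {k : Type*} [CommRing k] [Linear k C] [MonoidalLinear k C] [Linear k D]
    [MonoidalLinear k D] [R.Linear k] : (induced R hN).Linear k where
  map_smul f a := by
    obtain ⟨f, rfl⟩ := exists_map f
    exact congrArg (functor D).map (R.map_smul a f)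

instance [R.Faithful] : (induced R hN).Faithful where
  map_injective {X Y f g} h := by
    obtain ⟨f, rfl⟩ := exists_map f
    obtain ⟨g, rfl⟩ := exists_map g
    rw [← sub_eq_zero, ← Functor.map_sub] at h ⊢
    rw [← Functor.map_sub] at h
    exact (functor_map_eq_zero_iff _).2 (((functor_map_eq_zero_iff _).1 h).of_map R)

instance : (induced R hN).Monoidal :=
  Functor.CoreMonoidal.toMonoidal
    { εIso := (functor D).mapIso (Functor.Monoidal.εIso R)
      μIso := fun X Y => (functor D).mapIso (Functor.Monoidal.μIso R X.as Y.as)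
      μIso_hom_natural_left := fun f Z => by
        obtain ⟨f, rfl⟩ := exists_map f
        exact congrArg (functor D).map (Functor.LaxMonoidal.μ_natural_left (F := R) f Z.as)
      μIso_hom_natural_right := fun Z f => by
        obtain ⟨f, rfl⟩ := exists_map f
        exact congrArg (functor D).map (Functor.LaxMonoidal.μ_natural_right (F := R) Z.as f)
      associativity := fun X Y Z =>
        congrArg (functor D).map (Functor.LaxMonoidal.associativity (F := R) X.as Y.as Z.as)
      left_unitality := fun X =>
        congrArg (functor D).map (Functor.LaxMonoidal.left_unitality (F := R) X.as)
      right_unitality := fun X =>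
        congrArg (functor D).map (Functor.LaxMonoidal.right_unitality (F := R) X.as) }

instance : (induced R hN).Braided where
  braided X Y := congrArg (functor D).map (Functor.LaxBraided.braided (F := R) X.as Y.as)

lemma isMonoidal_eqToHom_functor_comp_induced :
    NatTrans.IsMonoidal (eqToHom (functor_comp_induced R hN)) where
  unit := by
    have h : (eqToHom (functor_comp_induced R hN)).app (𝟙_ C) = 𝟙 _ := eqToHom_app _ _
    rw [h]
    change (functor D).map ((Functor.LaxMonoidal.ε R ≫ R.map (𝟙 _)) ≫ 𝟙 _) =
      (functor D).map (𝟙 _ ≫ Functor.LaxMonoidal.ε R)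
    exact congrArg _ (by simp)
  tensor X Y := by
    have h (X : C) : (eqToHom (functor_comp_induced R hN)).app X = 𝟙 _ := eqToHom_app _ _
    rw [h, h, h]
    change (functor D).map ((Functor.LaxMonoidal.μ R X Y ≫ R.map (𝟙 _)) ≫ 𝟙 _) =
      (functor D).map ((𝟙 (R.obj X) ▷ R.obj Y ≫ R.obj X ◁ 𝟙 (R.obj Y)) ≫
        𝟙 _ ≫ Functor.LaxMonoidal.μ R X Y)
    exact congrArg _ (by simp)

end Semisimplification

end BraidedFunctor

/-! ### Exactness of additive functors on von Neumann regular categories -/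

namespace CategoryTheory
section Regular
universe v₁ v₂ u₁ u₂
variable {C : Type u₁} [Category.{v₁} C] [Preadditive C]
  {D : Type u₂} [Category.{v₂} D] [Preadditive D]
open Limits

variable (C) in
/-- A category is von Neumann regular if every morphism `f` has a pseudo-inverse `g`,
`f ≫ g ≫ f = f`. -/
def IsVonNeumannRegular : Prop := ∀ ⦃X Y : C⦄ (f : X ⟶ Y), ∃ g : Y ⟶ X, f ≫ g ≫ f = f

lemma IsVonNeumannRegular.op (hC : IsVonNeumannRegular C) : IsVonNeumannRegular Cᵒᵖ :=
    fun X Y f => by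
  obtain ⟨g, hg⟩ := hC f.unop
  exact ⟨g.op, Quiver.Hom.unop_inj (by simpa using hg)⟩

/-- For a limit cone `c` over `K`, the inclusion of `c.pt` into the product of the objects of `K` is
the kernel of a morphism `f` of biproducts. With `f ≫ g ≫ f = f` this kernel is split by the
projection `𝟙 - f ≫ g`, and additive functors preserve split kernels. -/
lemma IsVonNeumannRegular.preservesFiniteLimits [HasFiniteBiproducts C] (hC : IsVonNeumannRegular C)
    (F : C ⥤ D) [F.Additive] : PreservesFiniteLimits F where
  preservesFiniteLimits J _ _ := ⟨fun {K} => ⟨fun {c} hc => by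
    classical
    let A := Σ i : J, Σ j : J, (i ⟶ j)
    let P := ⨁ K.obj
    let Q := ⨁ fun a : A => K.obj a.2.1
    let f : P ⟶ Q := biproduct.lift fun a =>
      biproduct.π K.obj a.1 ≫ K.map a.2.2 - biproduct.π K.obj a.2.1
    have hf (a : A) : f ≫ biproduct.π _ a =
        biproduct.π K.obj a.1 ≫ K.map a.2.2 - biproduct.π K.obj a.2.1 :=
      biproduct.lift_π _ _
    obtain ⟨g, hg⟩ := hC f
    let e : P ⟶ P := 𝟙 P - f ≫ g
    have he : e ≫ f = 0 := by simp [e, Preadditive.sub_comp, hg]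
    -- `e` equalizes the two maps that define `f`, so its components form a cone over `K`
    let p : P ⟶ c.pt := hc.lift
      { pt := P
        π := { app := fun j => e ≫ biproduct.π K.obj j
               naturality := fun i j a => by
                have h := congrArg (e ≫ ·) (hf ⟨i, j, a⟩)
                simp only [reassoc_of% he, zero_comp, Preadditive.comp_sub] at h
                simpa using (sub_eq_zero.1 h.symm).symm } }
    have hp (j : J) : p ≫ c.π.app j = e ≫ biproduct.π K.obj j := hc.fac _ j
    let k : c.pt ⟶ P := biproduct.lift fun j => c.π.app j
    have hk (j : J) : k ≫ biproduct.π K.obj j = c.π.app j := biproduct.lift_π _ _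
    have hkf : k ≫ f = 0 := by
      apply biproduct.hom_ext
      intro a
      rw [Category.assoc, hf, Preadditive.comp_sub, reassoc_of% (hk a.1), hk, c.w, sub_self, zero_comp]
    have hkp : k ≫ p = 𝟙 _ := hc.hom_ext fun j => by
      rw [Category.assoc, hp]
      simp only [e, Preadditive.sub_comp, Preadditive.comp_sub, Category.id_comp, Category.assoc,
        reassoc_of% hkf, zero_comp, sub_zero, hk]
    -- the cone point of `s` maps to `F.obj P` through the sections `F.map (biproduct.ι _ j)`
    let l (s : Cone (K ⋙ F)) : s.pt ⟶ F.obj P := ∑ j, s.π.app j ≫ F.map (biproduct.ι K.obj j)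
    have hl (s : Cone (K ⋙ F)) (j : J) : l s ≫ F.map (biproduct.π K.obj j) = s.π.app j := by
      simp only [l, Preadditive.sum_comp, Category.assoc, ← F.map_comp, biproduct.ι_π]
      rw [Finset.sum_eq_single j]
      · simp
      · intro i _ hij
        simp [hij]
      · simp
    have hext {Z : D} (u w : Z ⟶ F.obj Q)
        (h : ∀ a, u ≫ F.map (biproduct.π _ a) = w ≫ F.map (biproduct.π _ a)) :
        u = w := by
      have ht : F.map (∑ a, biproduct.π _ a ≫ biproduct.ι (fun a : A => K.obj a.2.1) a) =
          𝟙 (F.obj Q) := by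
        rw [biproduct.total, F.map_id]
      rw [← Category.comp_id u, ← Category.comp_id w, ← ht, F.map_sum, Preadditive.comp_sum,
        Preadditive.comp_sum]
      exact Finset.sum_congr rfl fun a _ => by rw [F.map_comp, reassoc_of% (h a)]
    have hlf (s : Cone (K ⋙ F)) : l s ≫ F.map f = 0 := hext _ _ fun a => by
      rw [Category.assoc, ← F.map_comp, hf, F.map_sub, F.map_comp, Preadditive.comp_sub,
        reassoc_of% (hl s a.1), hl, zero_comp, sub_eq_zero]
      exact s.w a.2.2
    refine ⟨{ lift := fun s => l s ≫ F.map p, fac := fun s j => ?_, uniq := fun s m hm => ?_ }⟩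
    · change (l s ≫ F.map p) ≫ F.map (c.π.app j) = _
      rw [Category.assoc, ← F.map_comp, hp]
      simp only [e, Preadditive.sub_comp, F.map_sub, Category.id_comp, F.map_comp, Category.assoc,
        Preadditive.comp_sub, reassoc_of% (hlf s), zero_comp, sub_zero, hl]
    · have hk' : F.map k = ∑ j, F.map (c.π.app j) ≫ F.map (biproduct.ι K.obj j) := by
        rw [← Category.comp_id k, ← biproduct.total, Preadditive.comp_sum, F.map_sum]
        exact Finset.sum_congr rfl fun j _ => by rw [reassoc_of% (hk j), F.map_comp]
      have hm' : m ≫ F.map k = l s := by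
        rw [hk', Preadditive.comp_sum]
        exact Finset.sum_congr rfl fun j _ => by
          rw [← Category.assoc]
          exact congrArg (· ≫ _) (hm j)
      rw [← hm', Category.assoc, ← F.map_comp, hkp, F.map_id]
      exact (Category.comp_id m).symm⟩⟩

lemma IsVonNeumannRegular.preservesFiniteColimits [HasFiniteBiproducts C]
    (hC : IsVonNeumannRegular C) (F : C ⥤ D) [F.Additive] : PreservesFiniteColimits F :=
  have : HasFiniteBiproducts Cᵒᵖ := .of_hasFiniteProducts
  have := hC.op.preservesFiniteLimits F.op
  preservesFiniteColimits_of_op F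

end Regular
end CategoryTheory

/-! ### Finite biproducts -/

section Biproducts
open Limits

/-- The direct sum of two super vector spaces. -/
def SuperVect.bicone (X Y : SuperVect) : BinaryBicone X Y where
  pt := { V := ModuleCat.of ℂ (X.V × Y.V)
          p := ModuleCat.ofHom (X.p.hom.prodMap Y.p.hom)
          p_p := ModuleCat.hom_ext <| LinearMap.ext fun v =>
            Prod.ext (X.p_p_apply v.1) (Y.p_p_apply v.2) }
  fst := ⟨ModuleCat.ofHom (LinearMap.fst ℂ X.V Y.V), rfl⟩
  snd := ⟨ModuleCat.ofHom (LinearMap.snd ℂ X.V Y.V), rfl⟩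
  inl := ⟨ModuleCat.ofHom (LinearMap.inl ℂ X.V Y.V), ModuleCat.hom_ext <| LinearMap.ext fun _ =>
    Prod.ext rfl (map_zero Y.p.hom).symm⟩
  inr := ⟨ModuleCat.ofHom (LinearMap.inr ℂ X.V Y.V), ModuleCat.hom_ext <| LinearMap.ext fun _ =>
    Prod.ext (map_zero X.p.hom).symm rfl⟩

lemma SuperVect.bicone_total (X Y : SuperVect) :
    (X.bicone Y).fst ≫ (X.bicone Y).inl + (X.bicone Y).snd ≫ (X.bicone Y).inr = 𝟙 _ :=
  hom_ext <| ModuleCat.hom_ext <| LinearMap.ext fun v => Prod.ext (add_zero v.1) (zero_add v.2)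

section Comod
universe v u
variable {C : Type u} [Category.{v} C] [MonoidalCategory C] [Preadditive C] [MonoidalPreadditive C]
  {A : C} [ComonObj A]

/-- The comodule structure on a direct sum, given as a bicone `b` on the underlying objects. -/
def Comod.biconePt (M N : Comod A) (b : BinaryBicone M.X N.X)
    (hb : b.fst ≫ b.inl + b.snd ≫ b.inr = 𝟙 _) : Comod A where
  X := b.pt
  coact := b.fst ≫ M.coact ≫ b.inl ▷ A + b.snd ≫ N.coact ≫ b.inr ▷ A
  coact_counit := by
    rw [← cancel_mono (ρ_ _).hom, Iso.inv_hom_id, ← hb]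
    simp only [Preadditive.add_comp, Category.assoc]
    rw [← whisker_exchange_assoc, ← whisker_exchange_assoc, reassoc_of% M.coact_counit,
      reassoc_of% N.coact_counit, rightUnitor_naturality, rightUnitor_naturality,
      Iso.inv_hom_id_assoc, Iso.inv_hom_id_assoc]
  coact_comul := by
    simp only [Preadditive.add_comp, Preadditive.comp_add, Category.assoc,
      MonoidalPreadditive.add_whiskerRight, comp_whiskerRight]
    have h1 : b.inl ▷ A ≫ b.fst ▷ A = 𝟙 _ := by rw [← comp_whiskerRight, b.inl_fst, id_whiskerRight]
    have h2 : b.inl ▷ A ≫ b.snd ▷ A = 0 := by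
      rw [← comp_whiskerRight, b.inl_snd, MonoidalPreadditive.zero_whiskerRight]
    have h3 : b.inr ▷ A ≫ b.snd ▷ A = 𝟙 _ := by rw [← comp_whiskerRight, b.inr_snd, id_whiskerRight]
    have h4 : b.inr ▷ A ≫ b.fst ▷ A = 0 := by
      rw [← comp_whiskerRight, b.inr_fst, MonoidalPreadditive.zero_whiskerRight]
    rw [reassoc_of% h1, reassoc_of% h2, reassoc_of% h3, reassoc_of% h4, ← whisker_exchange,
      ← whisker_exchange, reassoc_of% M.coact_comul, reassoc_of% N.coact_comul,
      associator_naturality_left, associator_naturality_left]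
    simp only [zero_comp, comp_zero, add_zero, zero_add]

/-- The direct sum of two comodules. -/
def Comod.bicone (M N : Comod A) (b : BinaryBicone M.X N.X)
    (hb : b.fst ≫ b.inl + b.snd ≫ b.inr = 𝟙 _) : BinaryBicone M N where
  pt := M.biconePt N b hb
  fst := ⟨b.fst, by
    change (b.fst ≫ M.coact ≫ b.inl ▷ A + b.snd ≫ N.coact ≫ b.inr ▷ A) ≫ b.fst ▷ A = _
    simp only [Preadditive.add_comp, Category.assoc, ← comp_whiskerRight]
    simp
    rfl⟩
  snd := ⟨b.snd, by
    change (b.fst ≫ M.coact ≫ b.inl ▷ A + b.snd ≫ N.coact ≫ b.inr ▷ A) ≫ b.snd ▷ A = _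
    simp only [Preadditive.add_comp, Category.assoc, ← comp_whiskerRight]
    simp
    rfl⟩
  inl := ⟨b.inl, by
    change _ = b.inl ≫ (b.fst ≫ M.coact ≫ b.inl ▷ A + b.snd ≫ N.coact ≫ b.inr ▷ A)
    simp
    rfl⟩
  inr := ⟨b.inr, by
    change _ = b.inr ≫ (b.fst ≫ M.coact ≫ b.inl ▷ A + b.snd ≫ N.coact ≫ b.inr ▷ A)
    simp
    rfl⟩
  inl_fst := hom_ext b.inl_fst
  inl_snd := hom_ext b.inl_snd
  inr_fst := hom_ext b.inr_fst
  inr_snd := hom_ext b.inr_snd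

end Comod

section FinRep
variable (A : SuperVect) [HopfObj A]

/-- The zero representation. -/
def FinRep.zero : FinRep A where
  obj :=
    { X := { V := ModuleCat.of ℂ PUnit, p := 𝟙 _, p_p := Category.id_comp _ }
      coact := 0
      coact_counit := by
        rw [zero_comp, ← cancel_mono (ρ_ _).hom, Iso.inv_hom_id, zero_comp]
        exact SuperVect.hom_ext <| ModuleCat.hom_ext <| LinearMap.ext fun _ => rfl
      coact_comul := by rw [zero_comp, zero_comp] }
  property := Module.Finite.of_finite (M := PUnit)

instance : HasZeroObject (FinRep A) :=
  ⟨FinRep.zero A, (IsZero.iff_id_eq_zero _).2 <| FinRep.hom_ext <| SuperVect.hom_ext <|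
    ModuleCat.hom_ext <| LinearMap.ext fun _ => rfl⟩

instance : HasBinaryBiproducts (FinRep A) := ⟨fun M N => by
  let c := M.obj.bicone N.obj _ (M.obj.X.bicone_total N.obj.X)
  let b : BinaryBicone M N :=
    { pt := ⟨c.pt, by
        have : Module.Finite ℂ M.obj.X.V := M.property
        have : Module.Finite ℂ N.obj.X.V := N.property
        exact Module.Finite.prod (M := M.obj.X.V) (N := N.obj.X.V)⟩
      fst := ObjectProperty.homMk c.fst
      snd := ObjectProperty.homMk c.snd
      inl := ObjectProperty.homMk c.inl
      inr := ObjectProperty.homMk c.inr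
      inl_fst := ObjectProperty.hom_ext _ c.inl_fst
      inl_snd := ObjectProperty.hom_ext _ c.inl_snd
      inr_fst := ObjectProperty.hom_ext _ c.inr_fst
      inr_snd := ObjectProperty.hom_ext _ c.inr_snd }
  exact HasBinaryBiproduct.mk ⟨b, isBinaryBilimitOfTotal b <| FinRep.hom_ext <|
    M.obj.X.bicone_total N.obj.X⟩⟩

instance : HasFiniteBiproducts (FinRep A) :=
  have := hasFiniteProducts_of_has_binary_and_terminal (C := FinRep A)
  .of_hasFiniteProducts

end FinRep

instance {C : Type*} [Category* C] [MonoidalCategory C] [SymmetricCategory C]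
    [RightRigidCategory C] [Preadditive C] [MonoidalPreadditive C] [HasFiniteBiproducts C] :
    HasFiniteBiproducts (Semisimplification C) := ⟨fun _ => ⟨fun X =>
  HasBiproduct.mk
    ⟨(Semisimplification.functor C).mapBicone (biproduct.bicone fun i => (X i).as),
      isBilimitOfPreserves _ (biproduct.isBilimit fun i => (X i).as)⟩⟩⟩

end Biproducts

/-! ### Von Neumann regularity of the semisimplification -/

/-- Elements of a finite-dimensional algebra are strongly π-regular. -/
lemma exists_commute_pow_mul_pow_mul_eq (k : Type*) {R : Type*} [Field k] [Ring R] [Algebra k R]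
    [Module.Finite k R] (x : R) (n : ℕ) :
    ∃ m > n, ∃ b, Commute x b ∧ x ^ m * (x ^ m * b) = x ^ m := by
  have := Algebra.isMulCommutative_adjoin k (s := {x}) (by rintro _ rfl _ rfl; rfl)
  have : IsArtinianRing (Algebra.adjoin k {x}) := .of_finite k _
  let r : Algebra.adjoin k {x} := ⟨x, Algebra.self_mem_adjoin_singleton k x⟩
  obtain ⟨l, y, hy⟩ := IsArtinian.exists_pow_succ_smul_dvd r (1 : Algebra.adjoin k {x})
  rw [smul_eq_mul, smul_eq_mul, _root_.mul_one] at hy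
  have h (j : ℕ) : r ^ l = r ^ (l + j) * y ^ j := by
    induction j with
    | zero => simp
    | succ j ih => calc
        r ^ l = r ^ l * r ^ j * y ^ j := by rw [← pow_add, ← ih]
        _ = (r ^ (l + 1) * y) * r ^ j * y ^ j := by rw [hy]
        _ = _ := by ring
  let m := l + n + 1
  refine ⟨m, by omega, (y ^ m : Algebra.adjoin k {x}), ?_, ?_⟩
  · exact congrArg Subtype.val (mul_comm r (y ^ m))
  · have : r ^ m * (r ^ m * y ^ m) = r ^ m := by
      calc r ^ m * (r ^ m * y ^ m) = (r ^ (l + m) * y ^ m) * r ^ (n + 1) := by ring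
        _ = r ^ m := by rw [← h]; ring
    exact congrArg Subtype.val this

namespace Semisimplification
universe v u
variable {C : Type u} [Category.{v} C] [MonoidalCategory C] [SymmetricCategory C]
  [RightRigidCategory C] [Preadditive C] [MonoidalPreadditive C]
  {k : Type*} [Field k] [Linear k C] [MonoidalLinear k C]

lemma catTrace_eq_zero_of_negligible {X : C} {f : X ⟶ X} (hf : Negligible f) : catTrace f = 0 := by
  simpa using hf (𝟙 X)

/-- By Fitting's lemma an endomorphism that is nilpotent modulo negligible ones is the sum of a
negligible and a nilpotent endomorphism. -/
lemma catTrace_eq_zero_of_isNilpotent_map {X : C} [Module.Finite k (End X)]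
    (hnil : ∀ f : End X, IsNilpotent f → catTrace f.asHom = 0)
    (x : End X) (hx : IsNilpotent ((functor C).mapEnd X x)) : catTrace x.asHom = 0 := by
  obtain ⟨n, hn⟩ := hx
  obtain ⟨m, hm, b, hb, hxb⟩ := exists_commute_pow_mul_pow_mul_eq k x n
  have h0 : (functor C).mapEnd X (x * (x ^ m * b)) = 0 := by
    rw [map_mul, map_mul, map_pow, pow_eq_zero_of_le hm.le hn, zero_mul, mul_zero]
  have hc1 : Commute x (1 - x ^ m * b) :=
    (Commute.one_right x).sub_right (((Commute.refl x).pow_right m).mul_right hb)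
  have h1 : IsNilpotent (x * (1 - x ^ m * b)) := by
    refine ⟨m, ?_⟩
    obtain ⟨j, rfl⟩ : ∃ j, m = j + 1 := ⟨m - 1, by omega⟩
    rw [hc1.mul_pow, pow_succ' (1 - _), ← _root_.mul_assoc, mul_sub, hxb, _root_.mul_one,
      sub_self, zero_mul]
  have h2 : x = x * (x ^ m * b) + x * (1 - x ^ m * b) := by rw [← mul_add]; simp
  have h3 := hnil _ h1
  have h4 := catTrace_eq_zero_of_negligible ((functor_map_eq_zero_iff _).1 h0)
  rw [h2]
  exact (catTrace_add _ _).trans (by rw [h3]; rw [h4]; exact add_zero _)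

/-- The Jacobson radical vanishes: its elements pair to zero with every endomorphism, as nilpotent
endomorphisms have trace zero. -/
lemma isSemisimpleRing_end {X : C} [Module.Finite k (End X)]
    (hnil : ∀ f : End X, IsNilpotent f → catTrace f.asHom = 0) :
    IsSemisimpleRing (End ((functor C).obj X)) := by
  have : Module.Finite k (X ⟶ X) := ‹Module.Finite k (End X)›
  have : Module.Finite k (End ((functor C).obj X)) :=
    .of_surjective ((functor C).mapLinearMap k : (X ⟶ X) →ₗ[k] _) (functor C).map_surjective
  have : IsArtinianRing (End ((functor C).obj X)) := .of_finite k _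
  rw [IsArtinianRing.isSemisimpleRing_iff_jacobson, eq_bot_iff]
  intro a ha
  obtain ⟨n, hn⟩ := IsSemiprimaryRing.isNilpotent (R := End ((functor C).obj X))
  obtain ⟨x, rfl⟩ := exists_map a
  refine (functor_map_eq_zero_iff x).2 fun g => ?_
  refine catTrace_eq_zero_of_isNilpotent_map (k := k) hnil (.of (g ≫ x)) ⟨n, ?_⟩
  have h : (functor C).mapEnd X (.of (g ≫ x)) ∈ Ring.jacobson (End ((functor C).obj X)) := by
    have e : (functor C).mapEnd X (.of (g ≫ x)) =
        End.of ((functor C).map x) * End.of ((functor C).map g) :=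
      (functor C).map_comp g x
    rw [e]
    exact Ideal.mul_mem_right _ _ ha
  have h' := Ideal.pow_mem_pow h n
  rw [hn] at h'
  exact h'

/-- The left ideal `{f ≫ g}` of `End X` is generated by an idempotent `e = f ≫ g₀`. Then `e ≫ f - f`
becomes zero after composition with every `g`, so that it vanishes by the nondegeneracy of the trace
pairing. -/
lemma isVonNeumannRegular [∀ X : C, Module.Finite k (End X)]
    (hnil : ∀ (X : C) (f : End X), IsNilpotent f → catTrace f.asHom = 0) :
    IsVonNeumannRegular (Semisimplification C) := by
  rintro ⟨X⟩ ⟨Y⟩ (f : (functor C).obj X ⟶ (functor C).obj Y)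
  have := isSemisimpleRing_end (k := k) (hnil X)
  -- a left ideal, because multiplication in `End X` is `a * b = b ≫ a`
  let I : Ideal (End ((functor C).obj X)) :=
    { carrier := {a | ∃ g, a = f ≫ g}
      add_mem' := by
        rintro _ _ ⟨g, rfl⟩ ⟨g', rfl⟩
        exact ⟨g + g', (Preadditive.comp_add _ _ _ _ _ _).symm⟩
      zero_mem' := ⟨0, Limits.comp_zero.symm⟩
      smul_mem' := by
        rintro c _ ⟨g, rfl⟩
        exact ⟨g ≫ c, Category.assoc _ _ _⟩ }
  obtain ⟨e, he, hI⟩ := IsSemisimpleRing.ideal_eq_span_idempotent I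
  obtain ⟨g₀, hg₀⟩ : e ∈ I := hI ▸ Ideal.mem_span_singleton_self e
  have hex (g : (functor C).obj Y ⟶ (functor C).obj X) : e ≫ f ≫ g = f ≫ g := by
    have hg : End.of (f ≫ g) ∈ I := ⟨g, rfl⟩
    rw [hI, Ideal.mem_span_singleton'] at hg
    obtain ⟨c, hc⟩ := hg
    change End.of (f ≫ g) * e = End.of (f ≫ g)
    rw [← hc, _root_.mul_assoc, he.eq]
  refine ⟨g₀, ?_⟩
  change f ≫ g₀ ≫ f = f
  rw [← Category.assoc, ← hg₀, ← sub_eq_zero]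
  change e.asHom ≫ f - f = 0
  obtain ⟨x, hx⟩ := exists_map (e.asHom ≫ f - f)
  rw [hx]
  refine (functor_map_eq_zero_iff x).2 fun g => ?_
  rw [catTrace_comm]
  refine catTrace_eq_zero_of_negligible ((functor_map_eq_zero_iff _).1 ?_)
  rw [Functor.map_comp]
  have h := hex ((functor C).map g)
  have : (e.asHom ≫ f - f) ≫ (functor C).map g = 0 := by
    rw [Preadditive.sub_comp, Category.assoc, sub_eq_zero]; exact h
  rwa [hx] at this

end Semisimplification

/-! ### The trace in `Rep G` is the supertrace -/

section Supertrace
variable {V : Type} [AddCommGroup V] [Module ℂ V] [FiniteDimensional ℂ V]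

lemma contractLeft_koszulL (p : V →ₗ[ℂ] V) (hp : ∀ v, p (p v) = v) :
    contractLeft ℂ V ∘ₗ koszulL p p.dualMap =
      contractRight ℂ V ∘ₗ TensorProduct.map p LinearMap.id := by
  refine TensorProduct.ext' fun v φ => ?_
  simp only [LinearMap.comp_apply, koszulL_tmul, map_smul, map_add, map_sub, contractLeft_apply,
    TensorProduct.map_tmul, contractRight_apply, LinearMap.dualMap_apply, hp, LinearMap.id_apply,
    smul_eq_mul]
  ring

/-- The categorical trace of `f` is the supertrace, i.e. the trace of `p ∘ f`. -/
lemma contractLeft_koszulL_coevaluation (p f : V →ₗ[ℂ] V) (hp : ∀ v, p (p v) = v) :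
    contractLeft ℂ V (koszulL p p.dualMap (TensorProduct.map f LinearMap.id (coevaluation ℂ V 1))) =
      LinearMap.trace ℂ V (p ∘ₗ f) := by
  have h := LinearMap.congr_fun (contractLeft_koszulL p hp)
    (TensorProduct.map f LinearMap.id (coevaluation ℂ V 1))
  refine h.trans ?_
  classical
  rw [coevaluation_apply_one, LinearMap.trace_eq_matrix_trace ℂ (Module.Basis.ofVectorSpace ℂ V)]
  simp [Matrix.trace, LinearMap.toMatrix_apply, contractRight_apply]

end Supertrace

namespace FinRep
variable {A : SuperVect} [HopfObj A]

/-- The linear map that underlies a morphism of representations. -/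
def toLinearMap (M N : FinRep A) : (M ⟶ N) →ₗ[ℂ] (M.obj.X.V →ₗ[ℂ] N.obj.X.V) where
  toFun f := f.hom.hom.hom.hom
  map_add' _ _ := rfl
  map_smul' _ _ := rfl

lemma toLinearMap_injective (M N : FinRep A) : Function.Injective (toLinearMap M N) := fun _ _ h =>
  hom_ext (SuperVect.hom_ext (ModuleCat.hom_ext h))

instance (M : FinRep A) : Module.Finite ℂ (End M) :=
  have : Module.Finite ℂ M.obj.X.V := M.property
  .of_injective (toLinearMap M M) (toLinearMap_injective M M)

variable [IsCommMonObj A]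

lemma toLinearMap_catTrace {M : FinRep A} (f : M ⟶ M) :
    toLinearMap _ _ (catTrace f) (1 : ℂ) =
      LinearMap.trace ℂ M.obj.X.V (M.obj.X.p.hom ∘ₗ toLinearMap M M f) :=
  have : FiniteDimensional ℂ M.obj.X.V := M.property
  contractLeft_koszulL_coevaluation M.obj.X.p.hom (toLinearMap M M f) M.obj.X.p_p_apply

lemma catTrace_eq_zero_of_isNilpotent (M : FinRep A) (f : End M) (hf : IsNilpotent f) :
    catTrace f.asHom = 0 := by
  have : FiniteDimensional ℂ M.obj.X.V := M.property
  obtain ⟨n, hn⟩ := hf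
  let g : Module.End ℂ M.obj.X.V := toLinearMap M M f.asHom
  let p : Module.End ℂ M.obj.X.V := M.obj.X.p.hom
  have hpow (j : ℕ) : toLinearMap M M (f ^ j : End M).asHom = g ^ j := by
    induction j with
    | zero => rfl
    | succ j ih =>
      rw [_root_.pow_succ', _root_.pow_succ', ← ih]
      rfl
  have hg : g ^ n = 0 := by
    rw [← hpow, hn]
    rfl
  have hpg : Commute p g := (congrArg ModuleCat.Hom.hom f.asHom.hom.hom.comm).symm
  have hnil : IsNilpotent (p * g) := ⟨n, by rw [hpg.mul_pow, hg, mul_zero]⟩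
  have htr : LinearMap.trace ℂ _ (p * g) = 0 :=
    (LinearMap.isNilpotent_trace_of_isNilpotent hnil).eq_zero
  apply toLinearMap_injective
  apply LinearMap.ext_ring
  exact (toLinearMap_catTrace f.asHom).trans htr

lemma isVonNeumannRegular_semisimplification : IsVonNeumannRegular (Semisimplification (FinRep A)) :=
  Semisimplification.isVonNeumannRegular (k := ℂ) catTrace_eq_zero_of_isNilpotent

instance {B : SuperVect} [HopfObj B] (r : A ⟶ B) [IsBimonHom r] : (FinRep.res r).Faithful where
  map_injective h := hom_ext (congrArg (fun f => f.hom.hom) h)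

end FinRep

/-! ### Replacing `K`-invariant functionals by `G`-invariant ones -/

namespace AlgSupergroup
variable {G : AlgSupergroup} (K : G.ClosedSubgroup)

section Frobenius
variable (W : Comod G.A) (u : W.X ⟶ 𝟙_ SuperVect)

/-- The matrix coefficient map `w ↦ (g ↦ u(g w))` of a functional `u` on a representation. -/
def coefficient : W.X ⟶ G.A := W.coact ≫ u ▷ G.A ≫ (λ_ G.A).hom

lemma coefficient_comul : coefficient W u ≫ Δ[G.A] = W.coact ≫ coefficient W u ▷ G.A := by
  calc _ = W.coact ≫ u ▷ G.A ≫ 𝟙_ SuperVect ◁ Δ[G.A] ≫ (λ_ (G.A ⊗ G.A)).hom := by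
        rw [leftUnitor_naturality, coefficient, Category.assoc, Category.assoc]
    _ = (W.coact ≫ W.coact ▷ G.A ≫ (α_ _ _ _).hom) ≫ u ▷ (G.A ⊗ G.A) ≫ (λ_ _).hom := by
        rw [← W.coact_comul, Category.assoc, ← whisker_exchange_assoc]
    _ = _ := by
        rw [coefficient]; monoidal

/-- The matrix coefficients of a `K`-invariant functional are left `K`-invariant functions. -/
lemma coefficient_invDefect
    (hu : (W.coact ≫ W.X ◁ K.r) ≫ u ▷ K.group.A =
      u ≫ (λ_ (𝟙_ SuperVect)).inv ≫ 𝟙_ SuperVect ◁ η[K.group.A]) :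
    coefficient W u ≫ invDefect K = 0 := by
  have h : coefficient W u ≫ K.r = u ≫ η[K.group.A] := by
    rw [coefficient, Category.assoc, Category.assoc, ← leftUnitor_naturality,
      ← whisker_exchange_assoc, ← Category.assoc, ← Category.assoc, hu]
    simp
  rw [invDefect, Preadditive.comp_sub, sub_eq_zero, ← Category.assoc, coefficient_comul,
    Category.assoc, ← comp_whiskerRight, h, coefficient]
  simp

/-- On an invariant vector a matrix coefficient is constant. -/
lemma invariant_comp_coefficient (w : 𝟙_ SuperVect ⟶ W.X)
    (hw : ((λ_ (𝟙_ SuperVect)).inv ≫ 𝟙_ SuperVect ◁ η[G.A]) ≫ w ▷ G.A = w ≫ W.coact) :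
    w ≫ coefficient W u = (w ≫ u) ≫ η[G.A] := by
  rw [coefficient, ← Category.assoc, ← hw, Category.assoc, ← comp_whiskerRight_assoc,
    Category.assoc, whisker_exchange_assoc, leftUnitor_naturality, unitors_inv_equal,
    ← rightUnitor_inv_naturality_assoc, ← unitors_inv_equal, Iso.inv_hom_id_assoc]

/-- By Frobenius reciprocity a `K`-invariant functional `u` on `W` is a `G`-map from `W` to the module
induced from `ℂ`. Followed by a splitting it is a `G`-invariant functional, with the same values as
`u` on the `G`-invariant vectors, since those go to constant functions. -/
lemma exists_invariant_functional (hsplit : IsSplitting K)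
    (hu : (W.coact ≫ W.X ◁ K.r) ≫ u ▷ K.group.A =
      u ≫ (λ_ (𝟙_ SuperVect)).inv ≫ 𝟙_ SuperVect ◁ η[K.group.A]) :
    ∃ u' : W ⟶ 𝟙_ (Comod G.A), ∀ w : 𝟙_ (Comod G.A) ⟶ W,
      (w ≫ u').hom = w.hom ≫ u := by
  obtain ⟨a, ha⟩ := SuperVect.exists_lift (invDefect K) _ (coefficient_invDefect K W u hu)
  obtain ⟨⟨s, hs⟩⟩ := hsplit
  have hι : indCoact K ≫ SuperVect.kerι (invDefect K) ▷ G.A =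
    SuperVect.kerι (invDefect K) ≫ Δ[G.A] := (exists_indCoact K).choose_spec
  let i : 𝟙_ SuperVect ⟶ SuperVect.ker (invDefect K) := (indUnit K).hom
  have hη : i ≫ SuperVect.kerι (invDefect K) = η[G.A] :=
    (exists_indUnit K).choose_spec
  let t : W ⟶ indTrivial K := ⟨a, by
    change W.coact ≫ a ▷ G.A = a ≫ indCoact K
    rw [← cancel_mono (SuperVect.kerι (invDefect K) ▷ G.A), Category.assoc, Category.assoc, hι,
      ← comp_whiskerRight, ha, reassoc_of% ha, coefficient_comul]⟩
  refine ⟨t ≫ s, fun w => ?_⟩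
  let w' : 𝟙_ SuperVect ⟶ W.X := w.hom
  let s' : SuperVect.ker (invDefect K) ⟶ 𝟙_ SuperVect := s.hom
  have hwa : w' ≫ a = (w' ≫ u) ≫ i := by
    rw [← cancel_mono (SuperVect.kerι (invDefect K)), Category.assoc, Category.assoc, ha, hη,
      invariant_comp_coefficient W u w' w.comm]
  have his : i ≫ s' = 𝟙 _ := congrArg Comod.Hom.hom hs
  change w' ≫ a ≫ s' = w' ≫ u
  rw [reassoc_of% hwa, his, Category.comp_id]

end Frobenius

lemma negligible_res_map (hsplit : IsSplitting K) ⦃M N : G.Rep⦄ (f : M ⟶ N) (hf : Negligible f) :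
    Negligible ((Res K).map f) := by
  refine hf.map_of_functionals (Res K) fun W u => ?_
  obtain ⟨u', hu'⟩ := exists_invariant_functional K W.obj u.hom.hom hsplit u.hom.comm
  refine ⟨ObjectProperty.homMk u', fun w => FinRep.hom_ext ?_⟩
  exact (hu' w.hom).symm.trans (Category.comp_id _).symm

end AlgSupergroup

theorem mainTheorem4 (G : AlgSupergroup) (K : G.ClosedSubgroup) (hG : G.IsQuasireductive)
    (hK : K.group.IsQuasireductive) (hsplit : AlgSupergroup.IsSplitting K) :
    (∀ ⦃M N : G.Rep⦄ (f : M ⟶ N), Negligible f → Negligible ((AlgSupergroup.Res K).map f)) ∧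
    ∃ (F : Semisimplification G.Rep ⥤ Semisimplification K.group.Rep) (_ : F.Braided)
      (h : Semisimplification.functor G.Rep ⋙ F =
        AlgSupergroup.Res K ⋙ Semisimplification.functor K.group.Rep),
      NatTrans.IsMonoidal (eqToHom h) ∧ F.Additive ∧ F.Linear ℂ ∧ F.Faithful ∧
        Limits.PreservesFiniteLimits F ∧ Limits.PreservesFiniteColimits F := by
  have hN := AlgSupergroup.negligible_res_map K hsplit
  have hreg := FinRep.isVonNeumannRegular_semisimplification (A := G.A)
  exact ⟨hN, Semisimplification.induced _ hN, inferInstance,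
    Semisimplification.functor_comp_induced _ hN,
    Semisimplification.isMonoidal_eqToHom_functor_comp_induced _ hN, inferInstance, inferInstance,
    inferInstance, hreg.preservesFiniteLimits _, hreg.preservesFiniteColimits _⟩
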